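/- Let $Q$ be an $n$-dimensional smooth manifold (Hausdorff, second countable, without boundary), let $k\ge 1$, and let $T^{(k)}Q$ be the $k$-th order tangent bundle, i.e. the manifold of classes $[\gamma]^{(k)}_0$ of smooth local curves $\gamma$ in $Q$ under contact of order $k$ at $0$, with natural coordinates $q_{(j)}=\frac{d^j}{dt^j}\big|_0(\varphi\circ\gamma)$, $0\le j\le k$, for charts $\varphi$ of $Q$. The $k$-lift of a curve $\gamma$ in $Q$ is $\gamma^{(k)}(t)=[s\mapsto\gamma(t+s)]^{(k)}_0$, and $j_k\colon T^{(k)}Q\to T\,T^{(k-1)}Q$, $j_k([\gamma]^{(k)}_0)=\frac{d}{dt}\big|_{0}\gamma^{(k-1)}(t)$, is the canonical immersion. For a manifold $M$ let $\alpha_M\colon TT^*M\to T^*TM$ be Tulczyjew's isomorphism (the dual of the canonical flip of $TTM$; in natural coordinates $\alpha_M(q,p;\dot q,\dot p)=(q,\dot q;\dot p,p)$) and let $\tau\colon TT^*M\to T^*M$ be the tangent bundle projection; below $M=T^{(k-1)}Q$ and $\alpha=\alpha_M$. Let $L\in C^\infty(T^{(k)}Q)$ be a $k$-th order Lagrangian,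 let $$\Sigma_L=\{\mu\in T^*T\,T^{(k-1)}Q \mid j_k^*\mu=dL\}$$ (that is, $\mu\in T^*_{j_k(x)}T\,T^{(k-1)}Q$ with $\mu\circ T_xj_k=d_xL$ for some $x\in T^{(k)}Q$), let $N_L=\alpha^{-1}(\Sigma_L)\subset TT^*T^{(k-1)}Q$, and let $\mathbb{F}L=(\tau\circ\alpha^{-1})|_{\Sigma_L}\colon\Sigma_L\to T^*T^{(k-1)}Q$ be the higher-order Legendre transformation on $\Sigma_L$. Let $J\subset\mathbb{R}$ be open (for instance an open interval); all curves below are smooth on $J$. For a curve $\gamma\colon J\to Q$ and a curve $\mu\colon J\to\Sigma_L$ consider the conditions $$\pi(\mu(t))=j_k(\gamma^{(k)}(t)),\qquad \alpha^{-1}(\mu(t))=\frac{d}{dt}\,\mathbb{F}L(\mu(t))\qquad\text{for all }t\in J,\tag{$*$}$$ where $\pi\colon T^*T\,T^{(k-1)}Q\to T\,T^{(k-1)}Q$ is the projection. Then the solutions of the $k$-th order Lagrangian system are given by the curves $\mu$ satisfying $(*)$, in the following sense. 1. A curve $\gamma\colon J\to Q$ satisfies the $k$-th order Euler–Lagrange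 equations $$\sum_{j=0}^{k}(-1)^j\frac{d^j}{dt^j}\Bigl(\frac{\partial L}{\partial q^i_{(j)}}\Bigr)=0,\qquad 1\le i\le n,$$ along $\gamma^{(k)}$ in every chart of $Q$ if and only if there is a curve $\mu\colon J\to\Sigma_L$ such that $(\gamma,\mu)$ satisfies $(*)$; and for a given $\gamma$ there is at most one such $\mu$. 2. A curve $\sigma\colon J\to T^*T^{(k-1)}Q$ satisfies $\dot\sigma(t)\in N_L$ for all $t\in J$ if and only if there are curves $\gamma\colon J\to Q$ and $\mu\colon J\to\Sigma_L$ that satisfy $(*)$ and $\mathbb{F}L\circ\mu=\sigma$. -/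

import Mathlib

open Set Filter Topology
open scoped Manifold ContDiff Bundle

noncomputable section

namespace HigherOrderTangent

section Calculus

variable {E F : Type*} [NormedAddCommGroup E] [NormedSpace ℝ E]
  [NormedAddCommGroup F] [NormedSpace ℝ F]

/-- The derivatives up to order `k` of `φ ∘ f` at `0` depend only on those of `f`. -/
theorem iteratedDeriv_comp_congr {f g : ℝ → E} {φ : E → F} {k : ℕ}
    (hf : ContDiffAt ℝ ∞ f 0) (hg : ContDiffAt ℝ ∞ g 0) (hφ : ContDiffAt ℝ ∞ φ (f 0))
    (h : ∀ j ≤ k, iteratedDeriv j f 0 = iteratedDeriv j g 0) :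
    ∀ j ≤ k, iteratedDeriv j (φ ∘ f) 0 = iteratedDeriv j (φ ∘ g) 0 := by
  intro j hj
  have h0 : f 0 = g 0 := by simpa using h 0 (Nat.zero_le k)
  have hfg : ∀ i ≤ k, iteratedFDeriv ℝ i f 0 = iteratedFDeriv ℝ i g 0 := by
    intro i hi
    simp only [iteratedFDeriv_eq_equiv_comp, Function.comp_apply, h i hi]
  rw [iteratedDeriv_eq_iteratedFDeriv, iteratedDeriv_eq_iteratedFDeriv,
    iteratedFDeriv_comp hφ hf (by exact_mod_cast le_top),
    iteratedFDeriv_comp (h0 ▸ hφ) hg (by exact_mod_cast le_top), h0]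
  congr 1
  refine Finset.sum_congr rfl fun c _ => ?_
  simp only [FormalMultilinearSeries.compAlongOrderedFinpartition]
  congr 1
  funext m
  exact hfg _ ((c.partSize_le m).trans hj)

/-- The polynomial curve whose derivatives at `0` are `q 0, …, q k`. -/
def taylorCurve {k : ℕ} (q : Fin (k + 1) → E) (t : ℝ) : E :=
  ∑ i : Fin (k + 1), (t ^ (i : ℕ) / (Nat.factorial i : ℝ)) • q i

theorem contDiff_taylorCurve_uncurry {k : ℕ} :
    ContDiff ℝ ∞ (fun p : (Fin (k + 1) → E) × ℝ => taylorCurve p.1 p.2) := by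
  unfold taylorCurve
  fun_prop

theorem contDiff_taylorCurve {k : ℕ} (q : Fin (k + 1) → E) : ContDiff ℝ ∞ (taylorCurve q) := by
  unfold taylorCurve
  fun_prop

theorem iteratedDeriv_taylorCurve {k : ℕ} (q : Fin (k + 1) → E) (j : Fin (k + 1)) :
    iteratedDeriv j (taylorCurve q) 0 = q j := by
  have h1 : ∀ i : Fin (k + 1), iteratedDeriv j
      (fun t : ℝ => (t ^ (i : ℕ) / (Nat.factorial i : ℝ)) • q i) 0 = if i = j then q i else 0 := by
    intro i
    rw [iteratedDeriv_smul_const (by fun_prop) (q i)]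
    have h2 : (fun t : ℝ => t ^ (i : ℕ) / (Nat.factorial i : ℝ))
        = fun t : ℝ => t ^ (i : ℕ) / (Nat.factorial i : ℝ) := rfl
    rw [iteratedDeriv_div_const, iteratedDeriv_fun_pow_zero]
    by_cases hij : i = j
    · subst hij
      simp [Nat.factorial_ne_zero]
    · have : (j : ℕ) ≠ i := fun h => hij (Fin.ext h.symm)
      simp [hij, this]
  unfold taylorCurve
  rw [iteratedDeriv_fun_sum (fun i _ => by fun_prop)]
  simp [h1]

theorem taylorCurve_zero {k : ℕ} (q : Fin (k + 1) → E) : taylorCurve q 0 = q 0 := by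
  simpa using iteratedDeriv_taylorCurve q 0

/-- Smooth dependence of the derivatives of `φ ∘ taylorCurve q` on `q`. -/
theorem contDiffOn_iteratedDeriv_taylorCurve {k : ℕ} {φ : E → F} {U : Set E} (hU : IsOpen U)
    (hφ : ContDiffOn ℝ ∞ φ U) (j : ℕ) :
    ContDiffOn ℝ ∞
      (fun p : (Fin (k + 1) → E) × ℝ => iteratedDeriv j (fun t => φ (taylorCurve p.1 t)) p.2)
      {p | taylorCurve p.1 p.2 ∈ U} := by
  have hΩ : IsOpen {p : (Fin (k + 1) → E) × ℝ | taylorCurve p.1 p.2 ∈ U} :=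
    hU.preimage contDiff_taylorCurve_uncurry.continuous
  induction j with
  | zero =>
    simp only [iteratedDeriv_zero]
    exact hφ.comp contDiff_taylorCurve_uncurry.contDiffOn (fun p hp => hp)
  | succ j ih =>
    have h := (ih.fderiv_of_isOpen hΩ (m := ∞) (by simp)).clm_apply
      (contDiffOn_const (c := ((0 : Fin (k + 1) → E), (1 : ℝ))))
    refine h.congr fun p hp => ?_
    have hd : DifferentiableAt ℝ (fun p : (Fin (k + 1) → E) × ℝ =>
        iteratedDeriv j (fun t => φ (taylorCurve p.1 t)) p.2) p :=
      (ih.contDiffAt (hΩ.mem_nhds hp)).differentiableAt (by simp)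
    have hc : HasDerivAt (fun t : ℝ => (p.1, t)) ((0 : Fin (k + 1) → E), (1 : ℝ)) p.2 :=
      (hasDerivAt_const _ _).prodMk (hasDerivAt_id _)
    have := (hd.hasFDerivAt (x := (p.1, p.2))).comp_hasDerivAt p.2 hc
    rw [iteratedDeriv_succ]
    exact this.deriv

end Calculus

section Jets

variable (E : Type*) [NormedAddCommGroup E] [NormedSpace ℝ E]
  {Q : Type*} [TopologicalSpace Q] [ChartedSpace E Q]

/-- The curve `γ` is smooth on a neighbourhood of the time `t`. -/
def SmoothNear (γ : ℝ → Q) (t : ℝ) : Prop :=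
  ∀ᶠ s in 𝓝 t, ContMDiffAt 𝓘(ℝ, ℝ) 𝓘(ℝ, E) ∞ γ s

variable (Q) in
/-- A curve in `Q` that is smooth on a neighbourhood of the time `0`. -/
structure LocalCurve where
  /-- the underlying map; only its values near `0` matter -/
  toFun : ℝ → Q
  smooth : SmoothNear E toFun 0

theorem smoothNear_const (q : Q) (t : ℝ) : SmoothNear E (fun _ : ℝ => q) t :=
  Eventually.of_forall fun _ => contMDiffAt_const

open Classical in
/-- A map `γ : ℝ → Q` as a local curve. If `γ` is not smooth near `0` the result is
the constant curve (a junk value). -/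
def LocalCurve.ofFun (γ : ℝ → Q) : LocalCurve E Q :=
  if h : SmoothNear E γ 0 then ⟨γ, h⟩ else ⟨fun _ => γ 0, smoothNear_const E _ _⟩

variable {E}

theorem LocalCurve.ofFun_toFun {γ : ℝ → Q} (h : SmoothNear E γ 0) :
    (LocalCurve.ofFun E γ).toFun = γ := by
  simp [LocalCurve.ofFun, h]

theorem LocalCurve.ofFun_apply_zero (γ : ℝ → Q) : (LocalCurve.ofFun E γ).toFun 0 = γ 0 := by
  unfold LocalCurve.ofFun
  split_ifs <;> rfl

theorem SmoothNear.comp_chart {γ : ℝ → Q} {t : ℝ} (h : SmoothNear E γ t)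
    {e : OpenPartialHomeomorph Q E} (he : e ∈ IsManifold.maximalAtlas 𝓘(ℝ, E) ∞ Q)
    (ht : γ t ∈ e.source) : ∀ᶠ s in 𝓝 t, γ s ∈ e.source ∧ ContDiffAt ℝ ∞ (e ∘ γ) s := by
  have hc : ContinuousAt γ t := h.self_of_nhds.continuousAt
  filter_upwards [h, hc.preimage_mem_nhds (e.open_source.mem_nhds ht)] with s hs hs'
  exact ⟨hs', contMDiffAt_iff_contDiffAt.1 ((contMDiffAt_of_mem_maximalAtlas he hs').comp s hs)⟩

/-- Coordinate change between two charts of `Q`. -/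
theorem contDiffOn_coordChange {e e' : OpenPartialHomeomorph Q E}
    (he : e ∈ IsManifold.maximalAtlas 𝓘(ℝ, E) ∞ Q)
    (he' : e' ∈ IsManifold.maximalAtlas 𝓘(ℝ, E) ∞ Q) :
    ContDiffOn ℝ ∞ (e' ∘ e.symm) (e.symm.trans e').source := by
  rw [← contMDiffOn_iff_contDiffOn]
  refine (contMDiffOn_of_mem_maximalAtlas he').comp
    ((contMDiffOn_symm_of_mem_maximalAtlas he).mono ?_) ?_
  · intro x hx
    exact (by simpa using hx : x ∈ e.target ∧ e.symm x ∈ e'.source).1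
  · intro x hx
    exact (by simpa using hx : x ∈ e.target ∧ e.symm x ∈ e'.source).2

theorem smoothNear_taylorCurve {e : OpenPartialHomeomorph Q E}
    (he : e ∈ IsManifold.maximalAtlas 𝓘(ℝ, E) ∞ Q) {k : ℕ} {q : Fin (k + 1) → E} (hq : q 0 ∈ e.target) :
    SmoothNear E (fun t => e.symm (taylorCurve q t)) 0 := by
  have hc := (contDiff_taylorCurve q)
  have : taylorCurve q ⁻¹' e.target ∈ 𝓝 (0 : ℝ) :=
    hc.continuous.continuousAt.preimage_mem_nhds
      (e.open_target.mem_nhds (by rwa [taylorCurve_zero]))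
  filter_upwards [this] with s hs
  exact (contMDiffAt_symm_of_mem_maximalAtlas he hs).comp s hc.contMDiff.contMDiffAt

variable (E) in
/-- Two local curves have contact of order `k` at time `0` if they agree at `0` and, in some chart
of `Q` around the common point, their derivatives at `0` up to order `k` agree. -/
def Contact (k : ℕ) (γ₁ γ₂ : LocalCurve E Q) : Prop :=
  γ₁.toFun 0 = γ₂.toFun 0 ∧ ∃ e ∈ IsManifold.maximalAtlas 𝓘(ℝ, E) ∞ Q, γ₁.toFun 0 ∈ e.source ∧
    ∀ j ≤ k, iteratedDeriv j (e ∘ γ₁.toFun) 0 = iteratedDeriv j (e ∘ γ₂.toFun) 0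

theorem Contact.forall_chart {k : ℕ} {γ₁ γ₂ : LocalCurve E Q} (h : Contact E k γ₁ γ₂)
    {e : OpenPartialHomeomorph Q E} (he : e ∈ IsManifold.maximalAtlas 𝓘(ℝ, E) ∞ Q)
    (hs : γ₁.toFun 0 ∈ e.source) :
    ∀ j ≤ k, iteratedDeriv j (e ∘ γ₁.toFun) 0 = iteratedDeriv j (e ∘ γ₂.toFun) 0 := by
  obtain ⟨h0, e', he', hs', h'⟩ := h
  have hs₂ : γ₂.toFun 0 ∈ e.source := h0 ▸ hs
  have hs₂' : γ₂.toFun 0 ∈ e'.source := h0 ▸ hs'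
  have key := iteratedDeriv_comp_congr (φ := e ∘ e'.symm)
    (γ₁.smooth.comp_chart he' hs').self_of_nhds.2 (γ₂.smooth.comp_chart he' hs₂').self_of_nhds.2
    ((contDiffOn_coordChange he' he).contDiffAt
      ((e'.symm.trans e).open_source.mem_nhds (by simp [hs, hs']))) h'
  have aux : ∀ γ : LocalCurve E Q, γ.toFun 0 ∈ e'.source →
      (e ∘ e'.symm) ∘ (e' ∘ γ.toFun) =ᶠ[𝓝 0] e ∘ γ.toFun := by
    intro γ hγ
    filter_upwards [γ.smooth.comp_chart he' hγ] with s hs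
    simp [e'.left_inv hs.1]
  intro j hj
  rw [← (aux γ₁ hs').iteratedDeriv_eq j, ← (aux γ₂ hs₂').iteratedDeriv_eq j, key j hj]

variable [IsManifold 𝓘(ℝ, E) ∞ Q]

variable (E Q) in
/-- Contact of order `k` is an equivalence relation. -/
def contactSetoid (k : ℕ) : Setoid (LocalCurve E Q) where
  r := Contact E k
  iseqv :=
    { refl := fun γ => ⟨rfl, chartAt E (γ.toFun 0), IsManifold.chart_mem_maximalAtlas _,
        mem_chart_source E _, fun _ _ => rfl⟩
      symm := fun {γ₁ γ₂} ⟨h0, e, he, hs, h⟩ => ⟨h0.symm, e, he, h0 ▸ hs, fun j hj => (h j hj).symm⟩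
      trans := fun {γ₁ γ₂ γ₃} h h' => by
        refine ⟨h.1.trans h'.1, chartAt E (γ₁.toFun 0), IsManifold.chart_mem_maximalAtlas _,
          mem_chart_source E _, fun j hj => ?_⟩
        have hs := mem_chart_source E (γ₁.toFun 0)
        rw [h.forall_chart (IsManifold.chart_mem_maximalAtlas _) hs j hj]
        exact h'.forall_chart (IsManifold.chart_mem_maximalAtlas _) (h.1 ▸ hs) j hj }

end Jets

/-- The tangent bundle of order `k` of `Q`, written `T^(k) Q`: classes of local curves
under contact of order `k`. -/
def HOTangent (E : Type*) [NormedAddCommGroup E] [NormedSpace ℝ E]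
    (Q : Type*) [TopologicalSpace Q] [ChartedSpace E Q] [IsManifold 𝓘(ℝ, E) ∞ Q] (k : ℕ) : Type _ :=
  Quotient (contactSetoid E Q k)

namespace HOTangent

variable {E : Type*} [NormedAddCommGroup E] [NormedSpace ℝ E]
  {Q : Type*} [TopologicalSpace Q] [ChartedSpace E Q] [IsManifold 𝓘(ℝ, E) ∞ Q] {k : ℕ}

/-- The class `[γ]_0^(k)` of a local curve. -/
def mk (k : ℕ) (γ : LocalCurve E Q) : HOTangent E Q k := Quotient.mk (contactSetoid E Q k) γ

/-- The projection `τ^k : T^(k) Q → Q`, `[γ]_0^(k) ↦ γ 0`. -/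
def proj (x : HOTangent E Q k) : Q :=
  Quotient.lift (fun γ : LocalCurve E Q => γ.toFun 0)
    (fun _ _ (h : Contact E k _ _) => h.1) x

open Classical in
/-- The natural coordinates `q_(j) = d^j/dt^j (e ∘ γ) (0)`, `0 ≤ j ≤ k`, of `[γ]_0^(k)` induced by a
chart `e` of `Q` (and `0` outside of the domain of the induced chart). -/
def coord (e : OpenPartialHomeomorph Q E) (he : e ∈ IsManifold.maximalAtlas 𝓘(ℝ, E) ∞ Q)
    (x : HOTangent E Q k) : Fin (k + 1) → E :=
  Quotient.lift
    (fun γ : LocalCurve E Q => if γ.toFun 0 ∈ e.source then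
      (fun j : Fin (k + 1) => iteratedDeriv j (e ∘ γ.toFun) 0) else 0)
    (fun γ₁ γ₂ (h : Contact E k γ₁ γ₂) => by
      by_cases hs : γ₁.toFun 0 ∈ e.source
      · have hs₂ : γ₂.toFun 0 ∈ e.source := h.1 ▸ hs
        simp only [hs, hs₂, if_true]
        funext j
        exact Contact.forall_chart h he hs j (Nat.lt_succ_iff.1 j.2)
      · have hs₂ : γ₂.toFun 0 ∉ e.source := h.1 ▸ hs
        simp only [hs, hs₂, if_false]) x

/-- The point with natural coordinates `q` in the chart induced by `e`. -/
def ofCoord (e : OpenPartialHomeomorph Q E) (q : Fin (k + 1) → E) : HOTangent E Q k :=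
  mk k (LocalCurve.ofFun E fun t => e.symm (taylorCurve q t))

theorem proj_mk (γ : LocalCurve E Q) : proj (mk k γ) = γ.toFun 0 := rfl

theorem coord_mk {e : OpenPartialHomeomorph Q E}
    (he : e ∈ IsManifold.maximalAtlas 𝓘(ℝ, E) ∞ Q) {γ : LocalCurve E Q}
    (h : γ.toFun 0 ∈ e.source) :
    coord e he (mk k γ) = fun j : Fin (k + 1) => iteratedDeriv j (e ∘ γ.toFun) 0 := by
  exact if_pos h

theorem proj_ofCoord (e : OpenPartialHomeomorph Q E) (q : Fin (k + 1) → E) :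
    proj (ofCoord e q) = e.symm (q 0) := by
  unfold ofCoord
  rw [proj_mk, LocalCurve.ofFun_apply_zero, taylorCurve_zero]

theorem coord_ofCoord {e e' : OpenPartialHomeomorph Q E}
    (he : e ∈ IsManifold.maximalAtlas 𝓘(ℝ, E) ∞ Q) (he' : e' ∈ IsManifold.maximalAtlas 𝓘(ℝ, E) ∞ Q)
    {q : Fin (k + 1) → E} (hq : q 0 ∈ e.target) (hq' : e.symm (q 0) ∈ e'.source) :
    coord e' he' (ofCoord e q) =
      fun j : Fin (k + 1) => iteratedDeriv j (fun t => (e' ∘ e.symm) (taylorCurve q t)) 0 := by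
  unfold ofCoord
  rw [coord_mk, LocalCurve.ofFun_toFun (smoothNear_taylorCurve he hq)]
  · rfl
  · rwa [LocalCurve.ofFun_apply_zero, taylorCurve_zero]

theorem coord_ofCoord_self {e : OpenPartialHomeomorph Q E}
    (he : e ∈ IsManifold.maximalAtlas 𝓘(ℝ, E) ∞ Q) {q : Fin (k + 1) → E} (hq : q 0 ∈ e.target) :
    coord e he (ofCoord e q) = q := by
  rw [coord_ofCoord he he hq (e.map_target hq)]
  funext j
  rw [← iteratedDeriv_taylorCurve q j]
  refine Filter.EventuallyEq.iteratedDeriv_eq _ ?_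
  have : taylorCurve q ⁻¹' e.target ∈ 𝓝 (0 : ℝ) :=
    (contDiff_taylorCurve q).continuous.continuousAt.preimage_mem_nhds
      (e.open_target.mem_nhds (by rwa [taylorCurve_zero]))
  filter_upwards [this] with s hs
  exact e.right_inv hs

theorem ofCoord_coord {e : OpenPartialHomeomorph Q E}
    (he : e ∈ IsManifold.maximalAtlas 𝓘(ℝ, E) ∞ Q) {x : HOTangent E Q k}
    (hx : proj x ∈ e.source) : ofCoord e (coord e he x) = x := by
  induction x using Quotient.inductionOn with
  | h γ =>
    change γ.toFun 0 ∈ e.source at hx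
    change ofCoord e (coord e he (mk k γ)) = mk k γ
    have h0 : coord e he (mk k γ) 0 = e (γ.toFun 0) := by rw [coord_mk he hx]; simp
    have ht : coord e he (mk k γ) 0 ∈ e.target := by rw [h0]; exact e.map_source hx
    have hz : (LocalCurve.ofFun E fun t => e.symm (taylorCurve (coord e he (mk k γ)) t)).toFun 0
        = γ.toFun 0 := by
      rw [LocalCurve.ofFun_apply_zero, taylorCurve_zero, h0, e.left_inv hx]
    have hc := coord_ofCoord_self he ht
    unfold ofCoord at hc ⊢
    rw [coord_mk he (hz ▸ hx)] at hc
    refine Quotient.sound ⟨hz, e, he, hz ▸ hx, fun j hj => ?_⟩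
    rw [congrFun hc ⟨j, Nat.lt_succ_iff.2 hj⟩, coord_mk he hx]

/-- The chart of `T^(k) Q` induced by a chart of `Q`, before `T^(k) Q` gets its topology. -/
def partialChart (k : ℕ) (e : OpenPartialHomeomorph Q E)
    (he : e ∈ IsManifold.maximalAtlas 𝓘(ℝ, E) ∞ Q) :
    PartialEquiv (HOTangent E Q k) (Fin (k + 1) → E) where
  toFun := coord e he
  invFun := ofCoord e
  source := {x | proj x ∈ e.source}
  target := {q | q 0 ∈ e.target}
  map_source' := fun x hx => by
    induction x using Quotient.inductionOn with
    | h γ =>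
      change γ.toFun 0 ∈ e.source at hx
      change coord e he (mk k γ) 0 ∈ e.target
      rw [coord_mk he hx]
      simpa using e.map_source hx
  map_target' := fun q hq => by
    change proj (ofCoord e q) ∈ e.source
    rw [proj_ofCoord]
    exact e.map_target hq
  left_inv' := fun x hx => ofCoord_coord he hx
  right_inv' := fun q hq => coord_ofCoord_self he hq

theorem partialChart_trans_source {e e' : OpenPartialHomeomorph Q E}
    (he : e ∈ IsManifold.maximalAtlas 𝓘(ℝ, E) ∞ Q)
    (he' : e' ∈ IsManifold.maximalAtlas 𝓘(ℝ, E) ∞ Q) :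
    ((partialChart k e he).symm.trans (partialChart k e' he')).source
      = {q | q 0 ∈ (e.symm.trans e').source} := by
  ext q
  simp [partialChart, proj_ofCoord, PartialEquiv.trans_source]

/-- The coordinate changes of `T^(k) Q` are smooth. -/
theorem contDiffOn_partialChart_trans {e e' : OpenPartialHomeomorph Q E}
    (he : e ∈ IsManifold.maximalAtlas 𝓘(ℝ, E) ∞ Q)
    (he' : e' ∈ IsManifold.maximalAtlas 𝓘(ℝ, E) ∞ Q) :
    ContDiffOn ℝ ∞ ((partialChart k e he).symm.trans (partialChart k e' he'))
      ((partialChart k e he).symm.trans (partialChart k e' he')).source := by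
  rw [partialChart_trans_source]
  rw [contDiffOn_pi]
  intro j
  have h := (contDiffOn_iteratedDeriv_taylorCurve (k := k) (e.symm.trans e').open_source
    (contDiffOn_coordChange he he') j).comp
    (f := fun q : Fin (k + 1) → E => (q, (0 : ℝ))) (s := {q | q 0 ∈ (e.symm.trans e').source})
    (by fun_prop) (fun q hq => by
      change taylorCurve q 0 ∈ (e.symm.trans e').source
      rw [taylorCurve_zero]; exact hq)
  refine h.congr fun q hq => ?_
  have hq' : q 0 ∈ e.target ∧ e.symm (q 0) ∈ e'.source := by simpa using hq
  exact congrFun (coord_ofCoord he he' hq'.1 hq'.2) j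

variable (E Q k) in
/-- The manifold structure of `T^(k) Q`: the charts are those induced by the charts of `Q`. -/
def chartedSpaceCore : ChartedSpaceCore (Fin (k + 1) → E) (HOTangent E Q k) where
  atlas := {c | ∃ (e : OpenPartialHomeomorph Q E) (he : e ∈ atlas E Q),
    c = partialChart k e (IsManifold.subset_maximalAtlas he)}
  chartAt x := partialChart k (chartAt E (proj x)) (IsManifold.chart_mem_maximalAtlas _)
  mem_chart_source x := mem_chart_source E (proj x)
  chart_mem_atlas x := ⟨_, chart_mem_atlas E _, rfl⟩
  open_source := by
    rintro _ _ ⟨e, he, rfl⟩ ⟨e', he', rfl⟩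
    rw [partialChart_trans_source]
    exact (e.symm.trans e').open_source.preimage (continuous_apply 0)
  continuousOn_toFun := by
    rintro _ _ ⟨e, he, rfl⟩ ⟨e', he', rfl⟩
    exact (contDiffOn_partialChart_trans _ _).continuousOn

instance : TopologicalSpace (HOTangent E Q k) := (chartedSpaceCore E Q k).toTopologicalSpace

instance : ChartedSpace (Fin (k + 1) → E) (HOTangent E Q k) :=
  (chartedSpaceCore E Q k).toChartedSpace

instance : IsManifold 𝓘(ℝ, Fin (k + 1) → E) ∞ (HOTangent E Q k) := by
  refine isManifold_of_contDiffOn _ _ _ fun c c' hc hc' => ?_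
  obtain ⟨_, ⟨⟨d, rfl⟩, hd⟩⟩ := hc
  obtain ⟨_, ⟨⟨⟨e, he, rfl⟩, rfl⟩, rfl⟩⟩ := hd
  obtain ⟨_, ⟨⟨d', rfl⟩, hd'⟩⟩ := hc'
  obtain ⟨_, ⟨⟨⟨e', he', rfl⟩, rfl⟩, rfl⟩⟩ := hd'
  have := contDiffOn_partialChart_trans (k := k)
    (IsManifold.subset_maximalAtlas he : e ∈ IsManifold.maximalAtlas 𝓘(ℝ, E) ∞ Q)
    (IsManifold.subset_maximalAtlas he' : e' ∈ IsManifold.maximalAtlas 𝓘(ℝ, E) ∞ Q)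
  simp only [modelWithCornersSelf_coe, modelWithCornersSelf_coe_symm, Function.id_comp,
    Function.comp_id, preimage_id, range_id, inter_univ]
  exact this

variable (E k) in
/-- The `k`-lift `γ^(k) : t ↦ [s ↦ γ (t + s)]_0^(k)` of a curve `γ` in `Q`. -/
def lift (γ : ℝ → Q) (t : ℝ) : HOTangent E Q k := mk k (LocalCurve.ofFun E fun s => γ (t + s))

theorem proj_lift (γ : ℝ → Q) (t : ℝ) : proj (lift E k γ t) = γ t := by
  unfold lift
  rw [proj_mk, LocalCurve.ofFun_apply_zero, add_zero]

theorem coord_lift {γ : ℝ → Q} {t : ℝ} (h : SmoothNear E γ t) {e : OpenPartialHomeomorph Q E}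
    (he : e ∈ IsManifold.maximalAtlas 𝓘(ℝ, E) ∞ Q) (ht : γ t ∈ e.source) :
    coord e he (lift E k γ t) = fun j : Fin (k + 1) => iteratedDeriv j (e ∘ γ) t := by
  have hs : SmoothNear E (fun s => γ (t + s)) 0 := by
    have hc : Tendsto (fun s : ℝ => t + s) (𝓝 0) (𝓝 t) := by
      have : Continuous fun s : ℝ => t + s := by fun_prop
      simpa using this.tendsto 0
    filter_upwards [hc.eventually h] with s hs
    exact hs.comp s (contMDiff_const.add contMDiff_id).contMDiffAt
  unfold lift
  rw [coord_mk, LocalCurve.ofFun_toFun hs]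
  · funext j
    have := congrFun (iteratedDeriv_comp_const_add (n := j) (f := e ∘ γ) (s := t)) 0
    simpa [Function.comp_def] using this
  · rwa [LocalCurve.ofFun_apply_zero, add_zero]

/-- The velocity of the `k`-lift, in the natural coordinates induced by a chart of `Q`. -/
theorem hasMFDerivAt_lift {γ : ℝ → Q} {t : ℝ} (h : SmoothNear E γ t) :
    HasMFDerivAt 𝓘(ℝ, ℝ) 𝓘(ℝ, Fin (k + 1) → E) (lift E k γ) t
      (ContinuousLinearMap.toSpanSingleton ℝ
        (fun j : Fin (k + 1) => iteratedDeriv (j + 1) (chartAt E (γ t) ∘ γ) t)) := by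
  set e := chartAt E (γ t) with he_def
  have he : e ∈ IsManifold.maximalAtlas 𝓘(ℝ, E) ∞ Q := IsManifold.chart_mem_maximalAtlas _
  have hce := h.comp_chart he (mem_chart_source E (γ t))
  -- the curve in coordinates
  set c : ℝ → Fin (k + 1) → E := fun s j => iteratedDeriv j (e ∘ γ) s with hc_def
  have hd : HasDerivAt c (fun j : Fin (k + 1) => iteratedDeriv (j + 1) (e ∘ γ) t) t := by
    rw [hasDerivAt_pi]
    intro j
    have h1 : DifferentiableAt ℝ (iteratedDeriv j (e ∘ γ)) t := by
      rw [iteratedDeriv_eq_equiv_comp]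
      exact (LinearIsometryEquiv.differentiable _).differentiableAt.comp t
        (hce.self_of_nhds.2.differentiableAt_iteratedFDeriv
          (by exact_mod_cast WithTop.coe_lt_top (j : ℕ)))
    have h2 := h1.hasDerivAt
    rwa [← iteratedDeriv_succ] at h2
  have hcoord : ∀ᶠ s in 𝓝 t, coord e he (lift E k γ s) = c s := by
    filter_upwards [hce, h.eventually_nhds] with s hs hs'
    exact coord_lift hs' he hs.1
  have hpl : proj (lift E k γ t) = γ t := proj_lift γ t
  have hchart : ∀ y, chartAt (Fin (k + 1) → E) (lift E k γ t) y = coord e he y := by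
    intro y
    change coord (chartAt E (proj (lift E k γ t))) (IsManifold.chart_mem_maximalAtlas _) y = _
    congr 1
    rw [hpl]
  have hsymm : ∀ q, (chartAt (Fin (k + 1) → E) (lift E k γ t)).symm q = ofCoord e q := by
    intro q
    change ofCoord (chartAt E (proj (lift E k γ t))) q = _
    rw [hpl]
  refine ⟨?_, ?_⟩
  · have h1 : ContinuousAt ((chartAt (Fin (k + 1) → E) (lift E k γ t)).symm) (c t) := by
      refine (chartAt (Fin (k + 1) → E) (lift E k γ t)).symm.continuousAt ?_
      rw [← hcoord.self_of_nhds, ← hchart]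
      exact (chartAt (Fin (k + 1) → E) (lift E k γ t)).map_source (mem_chart_source _ _)
    refine (ContinuousAt.comp (f := c) (x := t) h1 hd.continuousAt).congr ?_
    filter_upwards [hce, hcoord] with s hs hs'
    rw [Function.comp_apply, hsymm, ← hs', ofCoord_coord he]
    rw [proj_lift]
    exact hs.1
  · have hf : HasFDerivAt (chartAt (Fin (k + 1) → E) (lift E k γ t) ∘ lift E k γ)
        (ContinuousLinearMap.toSpanSingleton ℝ
          (fun j : Fin (k + 1) => iteratedDeriv (j + 1) (e ∘ γ) t)) t := by
      refine hd.hasFDerivAt.congr_of_eventuallyEq ?_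
      filter_upwards [hcoord] with s hs
      rw [Function.comp_apply, hchart, hs]
    simp only [mfld_simps, writtenInExtChartAt]
    exact hf.hasFDerivWithinAt

/-- The velocity `d/dt γ^(k) (0)` in the natural coordinates of `T^(k) Q` around `[γ]_0^(k)`. -/
theorem mfderiv_lift {γ : ℝ → Q} {t : ℝ} (h : SmoothNear E γ t) :
    mfderiv 𝓘(ℝ, ℝ) 𝓘(ℝ, Fin (k + 1) → E) (lift E k γ) t (1 : ℝ) =
      fun j : Fin (k + 1) => iteratedDeriv (j + 1) (chartAt E (γ t) ∘ γ) t := by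
  rw [(hasMFDerivAt_lift h).mfderiv]
  exact one_smul ℝ _

theorem lift_zero (γ : LocalCurve E Q) : lift E k γ.toFun 0 = mk k γ := by
  unfold lift
  congr 1
  simp [LocalCurve.ofFun, γ.smooth]

variable (E Q k) in
/-- The canonical immersion `j_{k+1} : T^(k+1) Q → T (T^(k) Q)`, which sends `[γ]_0^(k+1)` to the
velocity at time `0` of the lift `γ^(k)`. -/
def canonicalImmersion (x : HOTangent E Q (k + 1)) :
    TangentBundle 𝓘(ℝ, Fin (k + 1) → E) (HOTangent E Q k) :=
  Quotient.lift
    (fun γ : LocalCurve E Q =>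
      (⟨lift E k γ.toFun 0, mfderiv 𝓘(ℝ, ℝ) 𝓘(ℝ, Fin (k + 1) → E) (lift E k γ.toFun) 0 (1 : ℝ)⟩ :
        TangentBundle 𝓘(ℝ, Fin (k + 1) → E) (HOTangent E Q k)))
    (fun γ₁ γ₂ (h : Contact E (k + 1) γ₁ γ₂) => by
      have hp : lift E k γ₁.toFun 0 = lift E k γ₂.toFun 0 := by
        rw [lift_zero, lift_zero]
        obtain ⟨h0, e, he, hs, h'⟩ := h
        exact Quotient.sound ⟨h0, e, he, hs, fun j hj => h' j (hj.trans (Nat.le_succ k))⟩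
      refine Bundle.TotalSpace.ext hp (heq_of_eq ?_)
      rw [mfderiv_lift γ₁.smooth, mfderiv_lift γ₂.smooth, ← h.1]
      funext j
      exact h.forall_chart (IsManifold.chart_mem_maximalAtlas _) (mem_chart_source E _) (j + 1)
        (Nat.succ_le_of_lt j.2)) x

end HOTangent

section TulczyjewIsomorphism

variable {E : Type*} [NormedAddCommGroup E] [NormedSpace ℝ E] {H : Type*} [TopologicalSpace H]
  (I : ModelWithCorners ℝ E H) (M : Type*) [TopologicalSpace M] [ChartedSpace H M]

/-- The cotangent space of `M` at `x`. -/
abbrev CotangentSpace (x : M) : Type _ := TangentSpace I x →L[ℝ] Bundle.Trivial M ℝ x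

variable [IsManifold I ∞ M]

/-- The cotangent bundle `T^* M`, as a smooth vector bundle. -/
abbrev CotangentBundle : Type _ := Bundle.TotalSpace (E →L[ℝ] ℝ) (CotangentSpace I M)

/-- The model with corners of the manifold `T^* M`. -/
abbrev cotangentModel : ModelWithCorners ℝ (E × (E →L[ℝ] ℝ)) (ModelProd H (E →L[ℝ] ℝ)) :=
  I.prod 𝓘(ℝ, E →L[ℝ] ℝ)

variable {I M}

/-- The canonical flip `κ : TTM → TTM`, `κ (q, v; q', v') = (q, q'; v, v')` in natural coordinates.

A point of `TTM` over `⟨q, v⟩ : TM` is given in Mathlib by its components `(q', v')` in the natural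
chart of `TM` that is induced by the preferred chart of `M` at `q`; the same holds for `T T^* M`. -/
def canonicalFlip (W : TangentBundle I.tangent (TangentBundle I M)) :
    TangentBundle I.tangent (TangentBundle I M) :=
  let q' : E := (show E × E from W.snd).1
  let v' : E := (show E × E from W.snd).2
  ⟨⟨W.proj.proj, q'⟩, ((W.proj.snd, v') : E × E)⟩

/-- The tangent map `Tπ : T T^* M → TM` of the projection `π : T^* M → M`. -/
def cotangentProjTangent (V : TangentBundle (cotangentModel I) (CotangentBundle I M)) :
    TangentBundle I M :=
  tangentMap (cotangentModel I) I (fun p : CotangentBundle I M => p.proj) V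

/-- The tangent map of the pairing `T^* M ×_M TM → ℝ`, a pairing `T T^* M ×_{TM} TTM → ℝ`. In natural
coordinates, for `V = (q, p; q', p')` and `W = (q, v; q', v')` it is the derivative
`p' v + p v'` of `p v`. -/
def tangentPairing (V : TangentBundle (cotangentModel I) (CotangentBundle I M))
    (W : TangentBundle I.tangent (TangentBundle I M)) : ℝ :=
  let p : E →L[ℝ] ℝ := V.proj.snd
  let p' : E →L[ℝ] ℝ := (show E × (E →L[ℝ] ℝ) from V.snd).2
  let v : E := W.proj.snd
  let v' : E := (show E × E from W.snd).2
  p' v + p v'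

variable (I M) in
/-- Tulczyjew's isomorphism `α_M : T T^* M → T^* TM`, which in natural coordinates is
`α_M (q, p; q', p') = (q, q'; p', p)`. -/
def tulczyjewAlpha : TangentBundle (cotangentModel I) (CotangentBundle I M) ≃
    CotangentBundle I.tangent (TangentBundle I M) where
  toFun V :=
    let p : E →L[ℝ] ℝ := V.proj.snd
    let q' : E := (show E × (E →L[ℝ] ℝ) from V.snd).1
    let p' : E →L[ℝ] ℝ := (show E × (E →L[ℝ] ℝ) from V.snd).2
    ⟨⟨V.proj.proj, q'⟩, (p'.coprod p : E × E →L[ℝ] ℝ)⟩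
  invFun μ :=
    let f : E × E →L[ℝ] ℝ := μ.snd
    ⟨⟨μ.proj.proj, (f ∘L ContinuousLinearMap.inr ℝ E E : E →L[ℝ] ℝ)⟩,
      ((μ.proj.snd, f ∘L ContinuousLinearMap.inl ℝ E E) : E × (E →L[ℝ] ℝ))⟩
  left_inv V := by
    obtain ⟨⟨q, p⟩, w⟩ := V
    change (⟨⟨q, _⟩, _⟩ : TangentBundle (cotangentModel I) (CotangentBundle I M)) = _
    have h1 : (ContinuousLinearMap.coprod (show E × (E →L[ℝ] ℝ) from w).2 (show E →L[ℝ] ℝ from p)) ∘L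
      ContinuousLinearMap.inr ℝ E E = p := ContinuousLinearMap.coprod_comp_inr _ _
    have h2 : (ContinuousLinearMap.coprod (show E × (E →L[ℝ] ℝ) from w).2 (show E →L[ℝ] ℝ from p)) ∘L
      ContinuousLinearMap.inl ℝ E E = (show E × (E →L[ℝ] ℝ) from w).2 :=
        ContinuousLinearMap.coprod_comp_inl _ _
    refine Bundle.TotalSpace.ext ?_ ?_
    · exact congrArg (Bundle.TotalSpace.mk q) h1
    · exact heq_of_eq (congrArg (Prod.mk (show E × (E →L[ℝ] ℝ) from w).1) h2)
  right_inv μ := by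
    obtain ⟨⟨q, v⟩, f⟩ := μ
    refine Bundle.TotalSpace.ext rfl (heq_of_eq ?_)
    exact ContinuousLinearMap.coprod_comp_inl_inr (show E × E →L[ℝ] ℝ from f)

/-- `α_M` is the dual of the canonical flip: `⟨α_M V, W⟩ = ⟨V, κ W⟩^T`. -/
theorem tulczyjewAlpha_dual (V : TangentBundle (cotangentModel I) (CotangentBundle I M))
    (W : TangentSpace I.tangent (tulczyjewAlpha I M V).proj) :
    (tulczyjewAlpha I M V).snd W
      = tangentPairing V (canonicalFlip ⟨(tulczyjewAlpha I M V).proj, W⟩) := by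
  rfl


/-- `α_M` covers `Tπ : T T^* M → TM`. -/
theorem tulczyjewAlpha_proj (V : TangentBundle (cotangentModel I) (CotangentBundle I M)) :
    (tulczyjewAlpha I M V).proj = cotangentProjTangent V := by
  obtain ⟨p, w⟩ := V
  have key : ∀ y ∈ (extChartAt (cotangentModel I) p).target,
      writtenInExtChartAt (cotangentModel I) I p (fun p : CotangentBundle I M => p.proj) y
        = y.1 := by
    intro y hy
    have h2 := (extChartAt (cotangentModel I) p).right_inv hy
    conv_rhs => rw [← h2]
    simp [writtenInExtChartAt, extChartAt, FiberBundle.chartedSpace_chartAt]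
    rfl
  have h : HasMFDerivAt (cotangentModel I) I (fun p : CotangentBundle I M => p.proj) p
      (ContinuousLinearMap.fst ℝ E (E →L[ℝ] ℝ)) := by
    refine ⟨(FiberBundle.continuous_proj (E →L[ℝ] ℝ) (CotangentSpace I M)).continuousAt, ?_⟩
    have h1 : HasFDerivWithinAt (Prod.fst : E × (E →L[ℝ] ℝ) → E)
      (ContinuousLinearMap.fst ℝ E (E →L[ℝ] ℝ)) (range (cotangentModel I))
      (extChartAt (cotangentModel I) p p) := hasFDerivWithinAt_fst
    refine h1.congr_of_eventuallyEq ?_ (key _ (mem_extChartAt_target p))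
    filter_upwards [extChartAt_target_mem_nhdsWithin (I := cotangentModel I) p] with y hy
    exact key y hy
  change _ = (⟨p.proj, mfderiv (cotangentModel I) I (fun p : CotangentBundle I M => p.proj) p w⟩ :
    TangentBundle I M)
  rw [h.mfderiv]
  rfl

/-- `tangentPairing` is the derivative of the pairing along curves. -/
theorem hasDerivAt_pairing {c : ℝ → M} (p : ∀ s, CotangentSpace I M (c s))
    (v : ∀ s, TangentSpace I (c s)) {t : ℝ}
    (hp : MDifferentiableAt 𝓘(ℝ, ℝ) (cotangentModel I)
      (fun s => (⟨c s, p s⟩ : CotangentBundle I M)) t)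
    (hv : MDifferentiableAt 𝓘(ℝ, ℝ) I.tangent (fun s => (⟨c s, v s⟩ : TangentBundle I M)) t) :
    HasDerivAt (fun s => (p s (v s) : ℝ))
      (tangentPairing
        ⟨_, mfderiv 𝓘(ℝ, ℝ) (cotangentModel I)
          (fun s => (⟨c s, p s⟩ : CotangentBundle I M)) t (1 : ℝ)⟩
        ⟨_, mfderiv 𝓘(ℝ, ℝ) I.tangent (fun s => (⟨c s, v s⟩ : TangentBundle I M)) t (1 : ℝ)⟩) t := by
  set e := trivializationAt E (TangentSpace I : M → Type _) (c t) with he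
  have hct : ContinuousAt c t :=
    ContinuousAt.comp (g := fun x : TangentBundle I M => x.proj)
      (FiberBundle.continuous_proj E (TangentSpace I : M → Type _)).continuousAt hv.continuousAt
  have hmem : ∀ᶠ s in 𝓝 t, c s ∈ e.baseSet :=
    hct.preimage_mem_nhds (e.open_baseSet.mem_nhds (FiberBundle.mem_baseSet_trivializationAt' _))
  have hp1 := hp.hasMFDerivAt.2
  have hv1 := hv.hasMFDerivAt.2
  have htriv : ∀ s, (p s : E →L[ℝ] ℝ) ∘L (e.symmL ℝ (c s) : E →L[ℝ] E) =
      (trivializationAt (E →L[ℝ] ℝ) (CotangentSpace I M) (c t) ⟨c s, p s⟩).2 := by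
    intro s
    rw [hom_trivializationAt_apply]
    refine ContinuousLinearMap.ext fun w => ?_
    simp only [ContinuousLinearMap.inCoordinates]
    exact (DFunLike.congr_fun
      (Bundle.Trivial.continuousLinearMapAt_trivialization (𝕜 := ℝ) (B := M) (F := ℝ) (c s))
      ((p s : E →L[ℝ] ℝ) (e.symmL ℝ (c s) w))).symm
  have hp2 : HasDerivAt (fun s => (p s : E →L[ℝ] ℝ) ∘L (e.symmL ℝ (c s) : E →L[ℝ] E))
      (show E × (E →L[ℝ] ℝ) from mfderiv 𝓘(ℝ, ℝ) (cotangentModel I)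
          (fun s => (⟨c s, p s⟩ : CotangentBundle I M)) t (1 : ℝ)).2 t := by
    have h3 : HasFDerivAt (fun s => ((extChartAt I (c t) (c s),
        (p s : E →L[ℝ] ℝ) ∘L (e.symmL ℝ (c s) : E →L[ℝ] E)) : E × (E →L[ℝ] ℝ)))
        (show ℝ →L[ℝ] E × (E →L[ℝ] ℝ) from mfderiv 𝓘(ℝ, ℝ) (cotangentModel I)
          (fun s => (⟨c s, p s⟩ : CotangentBundle I M)) t) t := by
      rw [← hasFDerivWithinAt_univ]
      simp only [writtenInExtChartAt, mfld_simps, extChartAt,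
        FiberBundle.chartedSpace_chartAt] at hp1
      exact hp1.congr_of_eventuallyEq (Eventually.of_forall fun s => Prod.ext rfl (htriv s))
        (Prod.ext rfl (htriv t))
    exact (hasFDerivAt_snd.comp t h3).hasDerivAt
  have hv2 : HasDerivAt (fun s => (e.continuousLinearMapAt ℝ (c s) (v s) : E))
      (show E × E from mfderiv 𝓘(ℝ, ℝ) I.tangent
          (fun s => (⟨c s, v s⟩ : TangentBundle I M)) t (1 : ℝ)).2 t := by
    have h3 : HasFDerivAt (fun s => ((extChartAt I (c t) (c s),
        (e ⟨c s, v s⟩).2) : E × E))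
        (show ℝ →L[ℝ] E × E from mfderiv 𝓘(ℝ, ℝ) I.tangent
          (fun s => (⟨c s, v s⟩ : TangentBundle I M)) t) t := by
      rw [← hasFDerivWithinAt_univ]
      simp only [writtenInExtChartAt, mfld_simps, extChartAt,
        FiberBundle.chartedSpace_chartAt] at hv1
      exact hv1
    have h4 := (hasFDerivAt_snd.comp t h3).hasDerivAt
    refine h4.congr_of_eventuallyEq ?_
    filter_upwards [hmem] with s hs
    exact congrFun (e.coe_linearMapAt_of_mem (R := ℝ) hs) (v s)
  have h := hp2.clm_apply hv2
  have hb := mem_chart_source H (c t)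
  have e1 : (e.continuousLinearMapAt ℝ (c t) (v t) : E) = v t :=
    (congrArg (fun f : E →L[ℝ] E => f (v t))
      (TangentBundle.continuousLinearMapAt_trivializationAt_eq_core (I := I) hb)).trans
      ((tangentBundleCore I M).coordChange_self (achart H (c t)) (c t) hb (v t))
  have e2 : (p t : E →L[ℝ] ℝ) ∘L (e.symmL ℝ (c t) : E →L[ℝ] E) = p t :=
    ContinuousLinearMap.ext fun w => congrArg (p t : E →L[ℝ] ℝ)
      ((congrArg (fun f : E →L[ℝ] E => f w)
        (TangentBundle.symmL_trivializationAt_eq_core (I := I) hb)).trans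
        ((tangentBundleCore I M).coordChange_self (achart H (c t)) (c t) hb w))
  rw [e1, e2] at h
  refine h.congr_of_eventuallyEq ?_
  filter_upwards [hmem] with s hs
  exact congrArg (p s) (e.symmL_continuousLinearMapAt hs (v s)).symm

/-- The velocity of `s ↦ Tχ (s a; b)` at `s = 0`, that is, the second derivative of
`(s, t) ↦ χ (s a + t b)` at `0`, an element of `TTM`. -/
def secondVelocity {V : Type*} [NormedAddCommGroup V] [NormedSpace ℝ V] (I : ModelWithCorners ℝ E H)
    [IsManifold I ∞ M] (χ : V → M) (a b : V) : TangentBundle I.tangent (TangentBundle I M) :=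
  ⟨tangentMap 𝓘(ℝ, V) I χ ⟨(0 : ℝ) • a, b⟩,
    mfderiv 𝓘(ℝ, ℝ) I.tangent (fun s : ℝ => tangentMap 𝓘(ℝ, V) I χ ⟨s • a, b⟩) 0 (1 : ℝ)⟩

theorem secondVelocity_eq {V : Type*} [NormedAddCommGroup V] [NormedSpace ℝ V] {χ : V → M}
    (hχ : ContMDiff 𝓘(ℝ, V) I ∞ χ) (a b : V) :
    secondVelocity I χ a b = ⟨⟨χ 0, fderiv ℝ (extChartAt I (χ 0) ∘ χ) 0 b⟩,
      ((fderiv ℝ (extChartAt I (χ 0) ∘ χ) 0 a,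
        fderiv ℝ (fderiv ℝ (extChartAt I (χ 0) ∘ χ)) 0 a b) : E × E)⟩ := by
  set f : V → E := extChartAt I (χ 0) ∘ χ with hf
  have hsrc : ∀ᶠ y in 𝓝 (0 : V), χ y ∈ (chartAt H (χ 0)).source :=
    hχ.continuous.continuousAt.preimage_mem_nhds (chart_source_mem_nhds H _)
  have hfd : ∀ᶠ y in 𝓝 (0 : V), ContDiffAt ℝ ∞ f y := by
    filter_upwards [hsrc] with y hy
    exact contMDiffAt_iff_contDiffAt.1 ((contMDiffAt_extChartAt' hy).comp y hχ.contMDiffAt)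
  have hf0 := hfd.self_of_nhds
  have htriv : ∀ᶠ y in 𝓝 (0 : V), ∀ w : V,
      (trivializationAt E (TangentSpace I : M → Type _) (χ 0)
        ⟨χ y, mfderiv 𝓘(ℝ, V) I χ y w⟩).2 = fderiv ℝ f y w := by
    filter_upwards [hsrc] with y hy w
    have h1 : fderiv ℝ f y = (mfderiv I 𝓘(ℝ, E) (extChartAt I (χ 0)) (χ y)).comp
        (mfderiv 𝓘(ℝ, V) I χ y) := by
      rw [← mfderiv_eq_fderiv]
      exact mfderiv_comp y (mdifferentiableAt_extChartAt hy)
        ((hχ.contMDiffAt (x := y)).mdifferentiableAt (by simp))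
    have h2 := TangentBundle.continuousLinearMapAt_trivializationAt (I := I) hy
    rw [h1]
    refine Eq.trans ?_ (DFunLike.congr_fun h2 (mfderiv 𝓘(ℝ, V) I χ y w))
    exact (congrFun ((trivializationAt E (TangentSpace I : M → Type _) (χ 0)).coe_linearMapAt_of_mem
      (R := ℝ) hy) _).symm
  have hb : (mfderiv 𝓘(ℝ, V) I χ 0 b : E) = fderiv ℝ f 0 b := by
    rw [← htriv.self_of_nhds b]
    exact ((tangentBundleCore I M).coordChange_self (achart H (χ 0)) (χ 0)
      (mem_chart_source H _) _).symm
  have hline : HasDerivAt (fun s : ℝ => s • a) a 0 := by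
    simpa using (hasDerivAt_id (0 : ℝ)).smul_const a
  have hlim : Tendsto (fun s : ℝ => s • a) (𝓝 0) (𝓝 0) := by
    simpa using hline.continuousAt.tendsto
  have hdf : HasFDerivAt f (fderiv ℝ f 0) ((0 : ℝ) • a) := by
    rw [zero_smul]
    exact (hf0.differentiableAt (by simp)).hasFDerivAt
  have hddf : HasFDerivAt (fderiv ℝ f) (fderiv ℝ (fderiv ℝ f) 0) ((0 : ℝ) • a) := by
    rw [zero_smul]
    exact ((hf0.fderiv_right (m := ∞) (by simp)).differentiableAt (by simp)).hasFDerivAt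
  have hd : HasDerivAt (fun s : ℝ => ((f (s • a), fderiv ℝ f (s • a) b) : E × E))
      (fderiv ℝ f 0 a, fderiv ℝ (fderiv ℝ f) 0 a b) 0 := by
    have hd1 : HasDerivAt (fun s : ℝ => f (s • a)) (fderiv ℝ f 0 a) 0 :=
      hdf.comp_hasDerivAt 0 hline
    have hd2 : HasDerivAt (fun s : ℝ => fderiv ℝ f (s • a)) (fderiv ℝ (fderiv ℝ f) 0 a) 0 :=
      hddf.comp_hasDerivAt 0 hline
    have hd3 := hd2.clm_apply (hasDerivAt_const (0 : ℝ) b)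
    rw [map_zero, add_zero] at hd3
    exact hd1.prodMk hd3
  have hm : HasMFDerivAt 𝓘(ℝ, ℝ) I.tangent
      (fun s : ℝ => tangentMap 𝓘(ℝ, V) I χ ⟨s • a, b⟩) 0
      (ContinuousLinearMap.toSpanSingleton ℝ
        ((fderiv ℝ f 0 a, fderiv ℝ (fderiv ℝ f) 0 a b) : E × E)) := by
    refine ⟨?_, ?_⟩
    · have h1 : Continuous fun s : ℝ => (⟨s • a, b⟩ : TangentBundle 𝓘(ℝ, V) V) :=
        (tangentBundleModelSpaceHomeomorph 𝓘(ℝ, V)).symm.continuous.comp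
          (by fun_prop : Continuous fun s : ℝ => ((s • a, b) : V × V))
      exact ((hχ.continuous_tangentMap (by simp)).comp h1).continuousAt
    · have h2 := hd.hasFDerivAt.hasFDerivWithinAt (s := univ)
      simp only [writtenInExtChartAt, mfld_simps, extChartAt, FiberBundle.chartedSpace_chartAt]
      simp only [tangentMap, zero_smul]
      refine h2.congr_of_eventuallyEq ?_ ?_
      · rw [nhdsWithin_univ]
        filter_upwards [hlim.eventually htriv] with s hs
        exact Prod.ext rfl (hs b)
      · refine Prod.ext rfl ?_
        have h3 : ∀ y : V, y = 0 → (trivializationAt E (TangentSpace I : M → Type _) (χ 0)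
            ⟨χ y, mfderiv 𝓘(ℝ, V) I χ y b⟩).2 = fderiv ℝ f y b := by
          rintro _ rfl
          exact htriv.self_of_nhds b
        exact h3 _ (zero_smul ℝ a)
  unfold secondVelocity
  rw [hm.mfderiv]
  refine Bundle.TotalSpace.ext ?_ (heq_of_eq (one_smul ℝ _))
  have hbase : ∀ y : V, y = 0 → (⟨χ y, mfderiv 𝓘(ℝ, V) I χ y b⟩ : TangentBundle I M)
      = ⟨χ 0, fderiv ℝ f 0 b⟩ := by
    rintro _ rfl
    exact congrArg (Bundle.TotalSpace.mk (χ 0)) hb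
  exact hbase _ (zero_smul ℝ a)

/-- The canonical flip exchanges the order of two derivatives. -/
theorem canonicalFlip_secondVelocity {V : Type*} [NormedAddCommGroup V] [NormedSpace ℝ V]
    {χ : V → M} (hχ : ContMDiff 𝓘(ℝ, V) I ∞ χ) (a b : V) :
    canonicalFlip (secondVelocity I χ a b) = secondVelocity I χ b a := by
  rw [secondVelocity_eq hχ, secondVelocity_eq hχ]
  have hf0 : ContDiffAt ℝ ∞ (extChartAt I (χ 0) ∘ χ) 0 :=
    contMDiffAt_iff_contDiffAt.1 (contMDiffAt_extChartAt.comp 0 hχ.contMDiffAt)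
  have hs : fderiv ℝ (fderiv ℝ (extChartAt I (χ 0) ∘ χ)) 0 a b
      = fderiv ℝ (fderiv ℝ (extChartAt I (χ 0) ∘ χ)) 0 b a :=
    (hf0.isSymmSndFDerivAt
      (by simpa using (ENat.LEInfty.out : (2 : WithTop ℕ∞) ≤ ∞))) a b
  rw [hs]
  rfl

end TulczyjewIsomorphism

section LagrangianSystem

variable {E : Type*} [NormedAddCommGroup E] [NormedSpace ℝ E]
  {Q : Type*} [TopologicalSpace Q] [ChartedSpace E Q] [IsManifold 𝓘(ℝ, E) ∞ Q] {m : ℕ}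

variable (E) in
/-- The model with corners of `T^(m) Q`. -/
abbrev jetModel (m : ℕ) : ModelWithCorners ℝ (Fin (m + 1) → E) (Fin (m + 1) → E) :=
  𝓘(ℝ, Fin (m + 1) → E)

variable (E Q) in
/-- The manifold `T^* T^(m) Q`. -/
abbrev MomentumSpace (m : ℕ) : Type _ := CotangentBundle (jetModel E m) (HOTangent E Q m)

variable (E Q) in
/-- The manifold `T^* T T^(m) Q`. -/
abbrev CotangentTangent (m : ℕ) : Type _ :=
  CotangentBundle (jetModel E m).tangent (TangentBundle (jetModel E m) (HOTangent E Q m))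

/-- The Lagrangian submanifold `Σ_L = {μ ∈ T^* T T^(m) Q | j^* μ = dL}` generated by a Lagrangian
`L : T^(m+1) Q → ℝ` of order `m + 1`, where `j : T^(m+1) Q → T T^(m) Q` is the canonical
immersion: `μ` is a covector at a point `j x`, and `μ ∘ T_x j = d_x L`. -/
def lagrangianSubmanifold (L : HOTangent E Q (m + 1) → ℝ) : Set (CotangentTangent E Q m) :=
  {μ | ∃ (x : HOTangent E Q (m + 1))
      (ν : CotangentSpace (jetModel E m).tangent (TangentBundle (jetModel E m) (HOTangent E Q m))
        (HOTangent.canonicalImmersion E Q m x)),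
    μ = ⟨HOTangent.canonicalImmersion E Q m x, ν⟩ ∧
    ∀ w : TangentSpace (jetModel E (m + 1)) x,
      ν (mfderiv (jetModel E (m + 1)) (jetModel E m).tangent
          (HOTangent.canonicalImmersion E Q m) x w)
        = mfderiv (jetModel E (m + 1)) 𝓘(ℝ, ℝ) L x w}

/-- The subset `N_L = α⁻¹ (Σ_L)` of `T T^* T^(m) Q`, an implicit differential equation. -/
def dynamicsSubmanifold (L : HOTangent E Q (m + 1) → ℝ) :
    Set (TangentBundle (cotangentModel (jetModel E m)) (MomentumSpace E Q m)) :=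
  {V | tulczyjewAlpha (jetModel E m) (HOTangent E Q m) V ∈ lagrangianSubmanifold L}

/-- The higher-order Legendre transformation `𝔽L : Σ_L → T^* T^(m) Q`, the restriction
of `τ ∘ α⁻¹` to `Σ_L`, where `τ : T T^* T^(m) Q → T^* T^(m) Q` is the projection. -/
def higherLegendre (L : HOTangent E Q (m + 1) → ℝ) :
    lagrangianSubmanifold L → MomentumSpace E Q m :=
  fun μ => ((tulczyjewAlpha (jetModel E m) (HOTangent E Q m)).symm (μ : CotangentTangent E Q m)).proj

/-- The velocity `dσ/dt (t) ∈ T T^* T^(m) Q` of a curve `σ` in `T^* T^(m) Q`. -/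
def velocity (σ : ℝ → MomentumSpace E Q m) (t : ℝ) :
    TangentBundle (cotangentModel (jetModel E m)) (MomentumSpace E Q m) :=
  ⟨σ t, mfderiv 𝓘(ℝ, ℝ) (cotangentModel (jetModel E m)) σ t (1 : ℝ)⟩

/-- The curve `γ` satisfies over `J` the Euler-Lagrange equations of order `m + 1`,
`∑_{j=0}^{m+1} (-1)^j d^j/dt^j (∂L/∂q_(j)) = 0`, in every chart `e` of `Q`. Here
`L ∘ ofCoord e` is `L` in the natural coordinates `(q_(0), …, q_(m+1))` induced by `e`. -/
def IsEulerLagrangeSolution (L : HOTangent E Q (m + 1) → ℝ) (J : Set ℝ) (γ : ℝ → Q) : Prop :=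
  ∀ e ∈ IsManifold.maximalAtlas 𝓘(ℝ, E) ∞ Q, ∀ t ∈ J, γ t ∈ e.source → ∀ v : E,
    ∑ j : Fin (m + 2), (-1 : ℝ) ^ (j : ℕ) *
      iteratedDeriv j (fun s => fderiv ℝ (fun q : Fin (m + 2) → E => L (HOTangent.ofCoord e q))
        (fun i : Fin (m + 2) => iteratedDeriv i (e ∘ γ) s) (Pi.single j v)) t = 0

/-- A curve `μ` in `Σ_L`, smooth on `J`, which projects onto the `(m+1)`-lift of `γ` and
satisfies `α⁻¹ (μ t) = d/dt 𝔽L (μ t)` for all `t ∈ J`. -/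
structure IsLegendreSolution (L : HOTangent E Q (m + 1) → ℝ) (J : Set ℝ) (γ : ℝ → Q)
    (μ : ℝ → lagrangianSubmanifold L) : Prop where
  smooth : ContMDiffOn 𝓘(ℝ, ℝ) (cotangentModel (jetModel E m).tangent) ∞
    (fun t => (μ t : CotangentTangent E Q m)) J
  proj_eq : ∀ t ∈ J, (μ t : CotangentTangent E Q m).proj =
    HOTangent.canonicalImmersion E Q m (HOTangent.lift E (m + 1) γ t)
  alpha_symm_eq : ∀ t ∈ J,
    (tulczyjewAlpha (jetModel E m) (HOTangent E Q m)).symm (μ t : CotangentTangent E Q m) =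
      velocity (fun s => higherLegendre L (μ s)) t

end LagrangianSystem

end HigherOrderTangent

end

open HigherOrderTangent

/-! Write k = m + 1. In natural coordinates the canonical immersion is the linear map w ↦ (head w,
tail w), where the head forgets the highest derivative and the tail forgets the value, and α(dσ/dt)
= (q, q'; p', p). So dσ/dt ∈ N_L splits into two conditions. The base point of α(dσ/dt) lies in the
image of j_k, that is q_(j)' = q_(j+1), so the base curve is the lift of a curve γ in Q. And p'(head
w) + p(tail w) = dL(w) for all w, which is `MomentumEquation`.

Testing the second condition on basis vectors gives a triangular system: p_m = ∂L/∂q_(m+1), p_(j-1)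
= ∂L/∂q_(j) - p_j' for 1 ≤ j ≤ m, and p_0' = ∂L/∂q_(0). The first two lines determine p from the top
down; these are the Ostrogradsky momenta. Unrolling the recursion turns the last line into the
Euler-Lagrange equation. Hence momenta over a given γ are unique, and they exist exactly when γ
solves Euler-Lagrange (`eq_ostrogradskyMomentum`, `ostrogradskyMomentum_equation`,
`ostrogradsky_apply_eq_sum`).

The condition (∗) says μ = α(dσ/dt) for σ = 𝔽L ∘ μ, so solutions μ and solutions σ of N_L determine
each other. This gives part 2, and uniqueness of μ from uniqueness of the momenta.

The global point is that the momentum equation does not depend on the chart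
(`MomentumEquation.change_chart`). The second derivatives of the coordinate change cancel by
symmetry, which also underlies the coordinate formula for α(dσ/dt). Uniqueness in each chart then
glues the local Ostrogradsky momenta to a curve in the cotangent bundle
(`momentumAt_ostrogradskyCurve`).

Fibre components of a bundle point refer to the preferred chart at its own base point, which moves
along a curve. Smoothness and derivatives are therefore always read off in a fixed chart, through
`momentumIn` and `momentumAt`. -/

noncomputable section

namespace HigherOrderTangent

/-! ### Derivatives of smooth curves -/

section SmoothCurves

variable {F : Type*} [NormedAddCommGroup F] [NormedSpace ℝ F]

theorem contDiffAt_deriv {f : ℝ → F} {t : ℝ} (hf : ContDiffAt ℝ ∞ f t) :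
    ContDiffAt ℝ ∞ (deriv f) t :=
  (hf.fderiv_right (m := ∞) (by simp)).clm_apply contDiffAt_const

theorem contDiffAt_iteratedDeriv {f : ℝ → F} {t : ℝ} (hf : ContDiffAt ℝ ∞ f t) (j : ℕ) :
    ContDiffAt ℝ ∞ (iteratedDeriv j f) t := by
  induction j with
  | zero => simpa using hf
  | succ j ih =>
    rw [iteratedDeriv_succ]
    exact contDiffAt_deriv ih

end SmoothCurves

/-! ### Curves in a cotangent bundle in a fixed natural chart -/

section CotangentCoordinates

variable {E : Type*} [NormedAddCommGroup E] [NormedSpace ℝ E] {H : Type*} [TopologicalSpace H]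
  {I : ModelWithCorners ℝ E H} {M : Type*} [TopologicalSpace M] [ChartedSpace H M]
  [IsManifold I ∞ M]

/-- The fibre coordinate of `p ∈ T^* M` in the natural chart of `T^* M` centred at `x₀`. -/
def momentumIn (x₀ : M) (p : CotangentBundle I M) : E →L[ℝ] ℝ :=
  (show E →L[ℝ] ℝ from p.snd) ∘L tangentCoordChange I x₀ p.proj p.proj

theorem momentumIn_eq_inCoordinates {x₀ : M} {p : CotangentBundle I M}
    (hp : p.proj ∈ (chartAt H x₀).source) :
    momentumIn x₀ p = ContinuousLinearMap.inCoordinates E (TangentSpace I : M → Type _) ℝ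
      (Bundle.Trivial M ℝ) x₀ p.proj x₀ p.proj p.snd := by
  refine ContinuousLinearMap.ext fun w => ?_
  simp only [ContinuousLinearMap.inCoordinates]
  refine Eq.trans ?_ (DFunLike.congr_fun
      (Bundle.Trivial.continuousLinearMapAt_trivialization (𝕜 := ℝ) (B := M) (F := ℝ) p.proj)
      ((p.snd : E →L[ℝ] ℝ) ((trivializationAt E (TangentSpace I : M → Type _) x₀).symmL ℝ p.proj w))).symm
  exact congrArg (p.snd : E →L[ℝ] ℝ) (DFunLike.congr_fun
    (TangentBundle.symmL_trivializationAt_eq_core (I := I) hp) w).symm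

theorem momentumIn_self (p : CotangentBundle I M) : momentumIn p.proj p = p.snd :=
  ContinuousLinearMap.ext fun _ => congrArg (p.snd : E →L[ℝ] ℝ)
    (tangentCoordChange_self (I := I) (mem_extChartAt_source p.proj))

/-- The smoothness criterion for Hom bundles, with the chart frozen at `σ t`. The bare fibre
component `(σ s).snd` would not do, since it refers to a chart that changes with `s`. -/
theorem contMDiffAt_cotangent_iff {σ : ℝ → CotangentBundle I M} {t : ℝ} :
    ContMDiffAt 𝓘(ℝ, ℝ) (cotangentModel I) ∞ σ t ↔
      ContMDiffAt 𝓘(ℝ, ℝ) I ∞ (fun s => (σ s).proj) t ∧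
        ContDiffAt ℝ ∞ (fun s => momentumIn (σ t).proj (σ s)) t := by
  rw [contMDiffAt_hom_bundle]
  refine and_congr_right fun h => ?_
  rw [← contMDiffAt_iff_contDiffAt]
  refine Filter.EventuallyEq.contMDiffAt_iff ?_
  filter_upwards [h.continuousAt.preimage_mem_nhds (chart_source_mem_nhds H _)] with s hs
  exact (momentumIn_eq_inCoordinates hs).symm

/-- The components of the velocity used to define `tulczyjewAlpha` are honest derivatives, because
the chart of the tangent bundle at `σ t` is the frozen one. -/
theorem hasDerivAt_cotangent {σ : ℝ → CotangentBundle I M} {t : ℝ}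
    (h : MDifferentiableAt 𝓘(ℝ, ℝ) (cotangentModel I) σ t) :
    HasDerivAt (fun s => extChartAt I (σ t).proj (σ s).proj)
      (show E × (E →L[ℝ] ℝ) from mfderiv 𝓘(ℝ, ℝ) (cotangentModel I) σ t (1 : ℝ)).1 t ∧
    HasDerivAt (fun s => momentumIn (σ t).proj (σ s))
      (show E × (E →L[ℝ] ℝ) from mfderiv 𝓘(ℝ, ℝ) (cotangentModel I) σ t (1 : ℝ)).2 t := by
  have hct : ContinuousAt (fun s => (σ s).proj) t :=
    ContinuousAt.comp (g := fun x : CotangentBundle I M => x.proj)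
      (FiberBundle.continuous_proj _ (CotangentSpace I M)).continuousAt h.continuousAt
  have h1 := h.hasMFDerivAt.2
  have h2 : HasFDerivAt (fun s => ((extChartAt I (σ t).proj (σ s).proj,
        momentumIn (σ t).proj (σ s)) : E × (E →L[ℝ] ℝ)))
        (show ℝ →L[ℝ] E × (E →L[ℝ] ℝ) from mfderiv 𝓘(ℝ, ℝ) (cotangentModel I) σ t) t := by
    rw [← hasFDerivWithinAt_univ]
    simp only [writtenInExtChartAt, mfld_simps, extChartAt,
        FiberBundle.chartedSpace_chartAt] at h1
    have key : ∀ s, (σ s).proj ∈ (chartAt H (σ t).proj).source →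
        momentumIn (σ t).proj (σ s) =
          (trivializationAt (E →L[ℝ] ℝ) (CotangentSpace I M) (σ t).proj (σ s)).2 := by
      intro s hs
      rw [momentumIn_eq_inCoordinates hs, hom_trivializationAt_apply]
    refine h1.congr_of_eventuallyEq ?_ (Prod.ext rfl (key t (mem_chart_source _ _)))
    refine Filter.Eventually.filter_mono nhdsWithin_le_nhds ?_
    filter_upwards [hct.preimage_mem_nhds (chart_source_mem_nhds H _)] with s hs
    exact Prod.ext rfl (key s hs)
  constructor
  · exact (hasFDerivAt_fst.comp t h2).hasDerivAt
  · exact (hasFDerivAt_snd.comp t h2).hasDerivAt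

end CotangentCoordinates

/-! ### Tulczyjew's isomorphism in natural coordinates -/

section TulczyjewSmooth

variable {E : Type*} [NormedAddCommGroup E] [NormedSpace ℝ E]
  {M : Type*} [TopologicalSpace M] [ChartedSpace E M] [IsManifold 𝓘(ℝ, E) ∞ M]

variable (E) in
/-- The transition map from the preferred chart at `x` to the preferred chart at `y`. -/
def transition (x y : M) : E → E := chartAt E y ∘ (chartAt E x).symm

theorem tangentCoordChange_eq_fderiv (x y z : M) :
    tangentCoordChange 𝓘(ℝ, E) x y z = fderiv ℝ (transition E x y) (chartAt E x z) := by
  rw [tangentCoordChange_def]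
  simp only [mfld_simps, fderivWithin_univ]
  rfl

theorem contDiffAt_transition {x y z : M} (hx : z ∈ (chartAt E x).source)
    (hy : z ∈ (chartAt E y).source) : ContDiffAt ℝ ∞ (transition E x y) (chartAt E x z) := by
  refine (contDiffOn_coordChange (IsManifold.chart_mem_maximalAtlas x)
    (IsManifold.chart_mem_maximalAtlas y)).contDiffAt
      (((chartAt E x).symm.trans (chartAt E y)).open_source.mem_nhds ?_)
  simp [hx, hy]

/-- The charts of `TM` change by (q, v) ↦ (ψ q, Dψ(q) v), and the formula is the differential of
this map. Its second-derivative term makes covectors on `TM` transform non-tensorially over `M`. -/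
theorem tangentCoordChange_tangent {p₀ p : TangentBundle 𝓘(ℝ, E) M}
    (hp : p.proj ∈ (chartAt E p₀.proj).source) (w : E × E) :
    tangentCoordChange 𝓘(ℝ, E).tangent p₀ p p w =
      (fderiv ℝ (transition E p₀.proj p.proj) (chartAt E p₀.proj p.proj) w.1,
        fderiv ℝ (fderiv ℝ (transition E p₀.proj p.proj)) (chartAt E p₀.proj p.proj) w.1
            (tangentCoordChange 𝓘(ℝ, E) p.proj p₀.proj p.proj p.snd) +
          fderiv ℝ (transition E p₀.proj p.proj) (chartAt E p₀.proj p.proj) w.2) := by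
  set ψ := transition E p₀.proj p.proj with hψ
  set q := chartAt E p₀.proj p.proj with hq
  set v : E := tangentCoordChange 𝓘(ℝ, E) p.proj p₀.proj p.proj p.snd with hv
  have hpp := mem_chart_source E p.proj
  have hsm : ContDiffAt ℝ ∞ ψ q := contDiffAt_transition hp hpp
  have hpt : extChartAt 𝓘(ℝ, E).tangent p₀ p = (q, v) := rfl
  have hΦ : ∀ᶠ z in 𝓝 ((q, v) : E × E),
      (extChartAt 𝓘(ℝ, E).tangent p ∘ (extChartAt 𝓘(ℝ, E).tangent p₀).symm) z
        = (ψ z.1, fderiv ℝ ψ z.1 z.2) := by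
    have h1 : ∀ᶠ y in 𝓝 q, y ∈ (chartAt E p₀.proj).target ∧
        (chartAt E p₀.proj).symm y ∈ (chartAt E p.proj).source := by
      have := ((chartAt E p₀.proj).symm.trans (chartAt E p.proj)).open_source.mem_nhds
        (x := q) (by simp [hq, hp])
      filter_upwards [this] with y hy
      simpa using hy
    filter_upwards [continuousAt_fst.preimage_mem_nhds h1] with z hz
    obtain ⟨hz1, hz2⟩ := hz
    set y := (chartAt E p₀.proj).symm z.1 with hy
    have hy1 : y ∈ (chartAt E p₀.proj).source := (chartAt E p₀.proj).map_target hz1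
    have hsymm : (extChartAt 𝓘(ℝ, E).tangent p₀).symm z =
        ⟨y, tangentCoordChange 𝓘(ℝ, E) p₀.proj y y z.2⟩ := by
      rfl
    rw [Function.comp_apply, hsymm]
    refine Prod.ext rfl ?_
    -- The vector at `y` is recorded in the preferred chart at `y`; the cocycle identity eliminates
    -- this intermediate chart.
    have h2 := tangentCoordChange_comp (I := 𝓘(ℝ, E)) (M := M) (w := p₀.proj) (x := y) (y := p.proj) (z := y)
      (v := z.2) (by simp [hy1, hz2])
    have h3 := tangentCoordChange_eq_fderiv (E := E) p₀.proj p.proj y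
    rw [hy, (chartAt E p₀.proj).right_inv hz1, ← hy] at h3
    rw [h3] at h2
    exact h2
  have hd : HasFDerivAt (fun z : E × E => (ψ z.1, fderiv ℝ ψ z.1 z.2))
      (((fderiv ℝ ψ q).comp (ContinuousLinearMap.fst ℝ E E)).prod
        ((fderiv ℝ ψ q).comp (ContinuousLinearMap.snd ℝ E E) +
          ((fderiv ℝ (fderiv ℝ ψ) q).comp (ContinuousLinearMap.fst ℝ E E)).flip v)) (q, v) := by
    have a1 : HasFDerivAt ψ (fderiv ℝ ψ q) ((q, v) : E × E).1 :=
      (hsm.differentiableAt (by simp)).hasFDerivAt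
    have a2 : HasFDerivAt (fderiv ℝ ψ) (fderiv ℝ (fderiv ℝ ψ) q) ((q, v) : E × E).1 :=
      ((hsm.fderiv_right (m := ∞) (by simp)).differentiableAt (by simp)).hasFDerivAt
    have b1 := a1.comp (q, v) (hasFDerivAt_fst (𝕜 := ℝ))
    have b2 := (a2.comp (q, v) (hasFDerivAt_fst (𝕜 := ℝ))).clm_apply (hasFDerivAt_snd (𝕜 := ℝ))
    exact b1.prodMk b2
  have := hd.congr_of_eventuallyEq hΦ
  rw [tangentCoordChange_def, hpt]
  rw [this.hasFDerivWithinAt.fderivWithin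
    (by rw [ModelWithCorners.range_eq_univ]; exact uniqueDiffWithinAt_univ)]
  refine Prod.ext rfl ?_
  exact add_comm _ _

theorem momentumIn_cotangentTangent {p₀ : TangentBundle 𝓘(ℝ, E) M}
    {μ : CotangentBundle 𝓘(ℝ, E).tangent (TangentBundle 𝓘(ℝ, E) M)}
    (hμ : μ.proj.proj ∈ (chartAt E p₀.proj).source) (w : E × E) :
    momentumIn p₀ μ w = (show E × E →L[ℝ] ℝ from μ.snd)
      (fderiv ℝ (transition E p₀.proj μ.proj.proj) (chartAt E p₀.proj μ.proj.proj) w.1,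
        fderiv ℝ (fderiv ℝ (transition E p₀.proj μ.proj.proj))
            (chartAt E p₀.proj μ.proj.proj) w.1
            (tangentCoordChange 𝓘(ℝ, E) μ.proj.proj p₀.proj μ.proj.proj μ.proj.snd) +
          fderiv ℝ (transition E p₀.proj μ.proj.proj) (chartAt E p₀.proj μ.proj.proj) w.2) :=
  congrArg (show E × E →L[ℝ] ℝ from μ.snd) (tangentCoordChange_tangent hμ w)

/-- The projection `T^* TM → T^* M`, `μ ↦ τ (α⁻¹ μ)`, restricts covectors to vertical vectors. -/
theorem momentumIn_tulczyjewAlpha_symm_proj {p₀ : TangentBundle 𝓘(ℝ, E) M}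
    {μ : CotangentBundle 𝓘(ℝ, E).tangent (TangentBundle 𝓘(ℝ, E) M)}
    (hμ : μ.proj.proj ∈ (chartAt E p₀.proj).source) :
    momentumIn p₀.proj ((tulczyjewAlpha 𝓘(ℝ, E) M).symm μ).proj =
      (momentumIn p₀ μ : E × E →L[ℝ] ℝ) ∘L ContinuousLinearMap.inr ℝ E E := by
  refine ContinuousLinearMap.ext fun b => ?_
  refine Eq.trans ?_ (momentumIn_cotangentTangent hμ ((0, b) : E × E)).symm
  have h := tangentCoordChange_eq_fderiv (E := E) p₀.proj μ.proj.proj μ.proj.proj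
  -- On a vertical vector (0, b) the second-derivative term vanishes, so the vertical part of a
  -- covector transforms like a covector on `M`.
  simp only [map_zero, zero_apply, zero_add]
  rw [← h]
  rfl

/-- In a fixed chart, τ ∘ α⁻¹ is composition with the constant inclusion of vertical vectors. This
yields smoothness of 𝔽L ∘ μ. -/
theorem contMDiffAt_tulczyjewAlpha_symm_proj
    {μ : ℝ → CotangentBundle 𝓘(ℝ, E).tangent (TangentBundle 𝓘(ℝ, E) M)} {t : ℝ}
    (h : ContMDiffAt 𝓘(ℝ, ℝ) (cotangentModel 𝓘(ℝ, E).tangent) ∞ μ t) :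
    ContMDiffAt 𝓘(ℝ, ℝ) (cotangentModel 𝓘(ℝ, E)) ∞
      (fun s => ((tulczyjewAlpha 𝓘(ℝ, E) M).symm (μ s)).proj) t := by
  obtain ⟨h1, h2⟩ := contMDiffAt_cotangent_iff.1 h
  have h3 : ContMDiffAt 𝓘(ℝ, ℝ) 𝓘(ℝ, E) ∞ (fun s => (μ s).proj.proj) t :=
    (Bundle.contMDiffAt_totalSpace.1 h1).1
  refine contMDiffAt_cotangent_iff.2 ⟨h3, ?_⟩
  refine ContDiffAt.congr_of_eventuallyEq (f := fun s =>
    (momentumIn (μ t).proj (μ s) : E × E →L[ℝ] ℝ) ∘L ContinuousLinearMap.inr ℝ E E) ?_ ?_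
  · exact h2.clm_comp contDiffAt_const
  · filter_upwards [h3.continuousAt.preimage_mem_nhds (chart_source_mem_nhds E _)] with s hs
    exact momentumIn_tulczyjewAlpha_symm_proj (p₀ := (μ t).proj) hs

theorem momentumIn_eq_comp_fderiv {x y : M} {p : CotangentBundle 𝓘(ℝ, E) M}
    (hx : p.proj ∈ (chartAt E x).source) (hy : p.proj ∈ (chartAt E y).source) :
    momentumIn x p = momentumIn y p ∘L fderiv ℝ (transition E x y) (chartAt E x p.proj) := by
  rw [← tangentCoordChange_eq_fderiv]
  refine ContinuousLinearMap.ext fun w => congrArg (show E →L[ℝ] ℝ from p.snd) ?_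
  exact (tangentCoordChange_comp (I := 𝓘(ℝ, E)) (by simp [hx, hy])).symm

theorem hasDerivAt_chartAt_comp {x₀ : M} {c : ℝ → M} {c' : E} {t : ℝ}
    (hc : HasDerivAt (fun s => chartAt E (c t) (c s)) c' t) (hct : ContinuousAt c t)
    (hx₀ : c t ∈ (chartAt E x₀).source) :
    HasDerivAt (fun s => chartAt E x₀ (c s)) (tangentCoordChange 𝓘(ℝ, E) (c t) x₀ (c t) c') t := by
  have h1 := ((contDiffAt_transition (mem_chart_source E (c t)) hx₀).differentiableAt
    (by simp)).hasFDerivAt.comp_hasDerivAt t hc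
  rw [tangentCoordChange_eq_fderiv]
  refine h1.congr_of_eventuallyEq ?_
  filter_upwards [hct.preimage_mem_nhds (chart_source_mem_nhds E _)] with s hs
  simp [transition, (chartAt E (c t)).left_inv hs]

/-- In natural coordinates centred at any point, `α (dσ/dt) = (q, q'; p', p)`. -/
theorem momentumIn_tulczyjewAlpha_velocity {σ : ℝ → CotangentBundle 𝓘(ℝ, E) M} {t : ℝ}
    (h : MDifferentiableAt 𝓘(ℝ, ℝ) (cotangentModel 𝓘(ℝ, E)) σ t) {p₀ : TangentBundle 𝓘(ℝ, E) M}
    (hx₀ : (σ t).proj ∈ (chartAt E p₀.proj).source) (w : E × E) :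
    momentumIn p₀ (tulczyjewAlpha 𝓘(ℝ, E) M
        ⟨σ t, mfderiv 𝓘(ℝ, ℝ) (cotangentModel 𝓘(ℝ, E)) σ t (1 : ℝ)⟩) w =
      deriv (fun s => momentumIn p₀.proj (σ s)) t w.1 + momentumIn p₀.proj (σ t) w.2 := by
  obtain ⟨h1, h2⟩ := hasDerivAt_cotangent h
  have hct : ContinuousAt (fun s => (σ s).proj) t :=
    ContinuousAt.comp (g := fun x : CotangentBundle 𝓘(ℝ, E) M => x.proj)
      (FiberBundle.continuous_proj _ (CotangentSpace 𝓘(ℝ, E) M)).continuousAt h.continuousAt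
  set V := (show E × (E →L[ℝ] ℝ) from
    mfderiv 𝓘(ℝ, ℝ) (cotangentModel 𝓘(ℝ, E)) σ t (1 : ℝ)) with hV
  set ψ := transition E p₀.proj (σ t).proj with hψ
  set q := chartAt E p₀.proj (σ t).proj with hq
  have hsm : ContDiffAt ℝ ∞ ψ q := contDiffAt_transition hx₀ (mem_chart_source E _)
  have h3 : HasDerivAt (fun s => chartAt E p₀.proj (σ s).proj)
      (tangentCoordChange 𝓘(ℝ, E) (σ t).proj p₀.proj (σ t).proj V.1) t :=
    hasDerivAt_chartAt_comp (c := fun s => (σ s).proj) h1 hct hx₀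
  set v : E := tangentCoordChange 𝓘(ℝ, E) (σ t).proj p₀.proj (σ t).proj V.1 with hv
  have h4 : HasDerivAt (fun s => fderiv ℝ ψ (chartAt E p₀.proj (σ s).proj))
      (fderiv ℝ (fderiv ℝ ψ) q v) t :=
    ((hsm.fderiv_right (m := ∞) (by simp)).differentiableAt
      (by simp)).hasFDerivAt.comp_hasDerivAt t h3
  have h5 := h2.clm_comp h4
  have h6 := h5.congr_of_eventuallyEq (f₁ := fun s => momentumIn p₀.proj (σ s)) (by
    filter_upwards [hct.preimage_mem_nhds (chart_source_mem_nhds E _),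
      hct.preimage_mem_nhds ((chartAt E p₀.proj).open_source.mem_nhds hx₀)] with s hs hs'
    exact momentumIn_eq_comp_fderiv hs' hs)
  rw [h6.deriv, momentumIn_eq_comp_fderiv hx₀ (mem_chart_source E _)]
  have h7 := momentumIn_cotangentTangent (p₀ := p₀) (μ := tulczyjewAlpha 𝓘(ℝ, E) M
        ⟨σ t, mfderiv 𝓘(ℝ, ℝ) (cotangentModel 𝓘(ℝ, E)) σ t (1 : ℝ)⟩) hx₀ w
  refine h7.trans ?_
  -- The coordinate change on `TM` produces D²ψ(w.1, v), while differentiating p ∘ Dψ along the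
  -- curve produces D²ψ(v, w.1). Symmetry of D²ψ identifies them, so the formula for α is the same
  -- in every natural chart.
  have h8 : fderiv ℝ (fderiv ℝ ψ) q w.1 v = fderiv ℝ (fderiv ℝ ψ) q v w.1 :=
    (hsm.isSymmSndFDerivAt
      (by simpa using (ENat.LEInfty.out : (2 : WithTop ℕ∞) ≤ ∞))) w.1 v
  have h9 := momentumIn_self (σ t)
  change V.2 (fderiv ℝ ψ q w.1) + (show E →L[ℝ] ℝ from (σ t).snd)
      (fderiv ℝ (fderiv ℝ ψ) q w.1 v + fderiv ℝ ψ q w.2) = _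
  rw [h9, h8, map_add]
  simp only [add_apply, ContinuousLinearMap.comp_apply]
  exact (add_assoc _ _ _).symm

/-- In the fixed chart the coordinates of α(dσ/dt) are (q, q'; p', p), built from derivatives of
smooth functions. Velocities at nearby times enter, whence the hypothesis on a whole neighbourhood.
-/
theorem contMDiffAt_tulczyjewAlpha_velocity {σ : ℝ → CotangentBundle 𝓘(ℝ, E) M} {t : ℝ}
    (h : ∀ᶠ s in 𝓝 t, ContMDiffAt 𝓘(ℝ, ℝ) (cotangentModel 𝓘(ℝ, E)) ∞ σ s) :
    ContMDiffAt 𝓘(ℝ, ℝ) (cotangentModel 𝓘(ℝ, E).tangent) ∞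
      (fun s => tulczyjewAlpha 𝓘(ℝ, E) M
        ⟨σ s, mfderiv 𝓘(ℝ, ℝ) (cotangentModel 𝓘(ℝ, E)) σ s (1 : ℝ)⟩) t := by
  obtain ⟨h1, h2⟩ := contMDiffAt_cotangent_iff.1 h.self_of_nhds
  have hnear : ∀ᶠ s in 𝓝 t, (σ s).proj ∈ (chartAt E (σ t).proj).source :=
    h1.continuousAt.preimage_mem_nhds (chart_source_mem_nhds E _)
  have h3 : ContDiffAt ℝ ∞ (fun s => chartAt E (σ t).proj (σ s).proj) t :=
    contMDiffAt_iff_contDiffAt.1 ((contMDiffAt_of_mem_maximalAtlas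
      (IsManifold.chart_mem_maximalAtlas _) (mem_chart_source E _)).comp t h1)
  refine contMDiffAt_cotangent_iff.2 ⟨Bundle.contMDiffAt_totalSpace.2 ⟨h1, ?_⟩, ?_⟩
  · rw [contMDiffAt_iff_contDiffAt]
    refine (contDiffAt_deriv h3).congr_of_eventuallyEq ?_
    filter_upwards [hnear, h] with s hs hs'
    have h4 := (hasDerivAt_cotangent (hs'.mdifferentiableAt (by simp))).1
    have h5 := hasDerivAt_chartAt_comp (c := fun s => (σ s).proj) h4
      (contMDiffAt_cotangent_iff.1 hs').1.continuousAt hs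
    exact h5.deriv.symm
  · refine ContDiffAt.congr_of_eventuallyEq (f := fun s =>
      ((deriv (fun s => momentumIn (σ t).proj (σ s)) s).coprod (momentumIn (σ t).proj (σ s)) :
        E × E →L[ℝ] ℝ)) ?_ ?_
    · have h6 : (fun s => ((deriv (fun s => momentumIn (σ t).proj (σ s)) s).coprod
          (momentumIn (σ t).proj (σ s)) : E × E →L[ℝ] ℝ)) = fun s =>
          deriv (fun s => momentumIn (σ t).proj (σ s)) s ∘L ContinuousLinearMap.fst ℝ E E +
            momentumIn (σ t).proj (σ s) ∘L ContinuousLinearMap.snd ℝ E E := by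
        funext s
        ext <;> simp
      rw [h6]
      exact ((contDiffAt_deriv h2).clm_comp contDiffAt_const).add (h2.clm_comp contDiffAt_const)
    · filter_upwards [hnear, h] with s hs hs'
      exact ContinuousLinearMap.ext fun w =>
        momentumIn_tulczyjewAlpha_velocity (hs'.mdifferentiableAt (by simp))
          (p₀ := (tulczyjewAlpha 𝓘(ℝ, E) M
            ⟨σ t, mfderiv 𝓘(ℝ, ℝ) (cotangentModel 𝓘(ℝ, E)) σ t (1 : ℝ)⟩).proj) hs w

end TulczyjewSmooth

/-! ### Jets of curves and coordinate changes of `T^(k) Q` -/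

section Jets

variable {E : Type*} [NormedAddCommGroup E] [NormedSpace ℝ E]

/-- The derivatives up to order `k` of a curve in a vector space. -/
def jet (k : ℕ) (c : ℝ → E) (t : ℝ) : Fin (k + 1) → E := fun j => iteratedDeriv j c t

variable (E) in
/-- Forget the highest derivative. -/
def headL (k : ℕ) : (Fin (k + 2) → E) →L[ℝ] (Fin (k + 1) → E) :=
  ContinuousLinearMap.pi fun j => ContinuousLinearMap.proj j.castSucc

variable (E) in
/-- Forget the value and shift the derivatives. -/
def tailL (k : ℕ) : (Fin (k + 2) → E) →L[ℝ] (Fin (k + 1) → E) :=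
  ContinuousLinearMap.pi fun j => ContinuousLinearMap.proj j.succ

theorem headL_jet (k : ℕ) (c : ℝ → E) (t : ℝ) : headL E k (jet (k + 1) c t) = jet k c t := rfl

theorem jet_zero (k : ℕ) (c : ℝ → E) (t : ℝ) : jet k c t 0 = c t := by simp [jet]

theorem contDiffAt_jet {k : ℕ} {c : ℝ → E} {t : ℝ} (h : ContDiffAt ℝ ∞ c t) :
    ContDiffAt ℝ ∞ (jet k c) t :=
  contDiffAt_pi.2 fun j => contDiffAt_iteratedDeriv h j

theorem hasDerivAt_jet {k : ℕ} {c : ℝ → E} {t : ℝ} (h : ContDiffAt ℝ ∞ c t) :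
    HasDerivAt (jet k c) (tailL E k (jet (k + 1) c t)) t := by
  refine hasDerivAt_pi.2 fun j => ?_
  have := ((contDiffAt_iteratedDeriv h j).differentiableAt (by simp)).hasDerivAt
  rw [← iteratedDeriv_succ] at this
  exact this

variable {Q : Type*} [TopologicalSpace Q] [ChartedSpace E Q]

theorem SmoothNear.contDiffAt_chart {γ : ℝ → Q} {t : ℝ} (h : SmoothNear E γ t)
    {e : OpenPartialHomeomorph Q E} (he : e ∈ IsManifold.maximalAtlas 𝓘(ℝ, E) ∞ Q)
    (ht : γ t ∈ e.source) : ContDiffAt ℝ ∞ (e ∘ γ) t :=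
  (h.comp_chart he ht).self_of_nhds.2

variable [IsManifold 𝓘(ℝ, E) ∞ Q] {k m : ℕ}

theorem coord_lift_eq_jet {γ : ℝ → Q} {t : ℝ} (h : SmoothNear E γ t)
    {e : OpenPartialHomeomorph Q E} (he : e ∈ IsManifold.maximalAtlas 𝓘(ℝ, E) ∞ Q)
    (ht : γ t ∈ e.source) :
    HOTangent.coord e he (HOTangent.lift E k γ t) = jet k (e ∘ γ) t :=
  HOTangent.coord_lift h he ht

theorem ofCoord_jet {γ : ℝ → Q} {t : ℝ} (h : SmoothNear E γ t)
    {e : OpenPartialHomeomorph Q E} (he : e ∈ IsManifold.maximalAtlas 𝓘(ℝ, E) ∞ Q)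
    (ht : γ t ∈ e.source) :
    HOTangent.ofCoord e (jet k (e ∘ γ) t) = HOTangent.lift E k γ t := by
  rw [← coord_lift_eq_jet h he ht, HOTangent.ofCoord_coord he]
  rwa [HOTangent.proj_lift]

/-- The change of natural coordinates of `T^(k) Q` induced by two charts of `Q`. -/
def jetTransition (k : ℕ) (e e' : OpenPartialHomeomorph Q E)
    (he' : e' ∈ IsManifold.maximalAtlas 𝓘(ℝ, E) ∞ Q) (q : Fin (k + 1) → E) : Fin (k + 1) → E :=
  HOTangent.coord e' he' (HOTangent.ofCoord e q)

section Transition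

variable {e e' e'' : OpenPartialHomeomorph Q E} (he : e ∈ IsManifold.maximalAtlas 𝓘(ℝ, E) ∞ Q)
  (he' : e' ∈ IsManifold.maximalAtlas 𝓘(ℝ, E) ∞ Q)
  (he'' : e'' ∈ IsManifold.maximalAtlas 𝓘(ℝ, E) ∞ Q)

omit [NormedSpace ℝ E] [ChartedSpace E Q] [IsManifold 𝓘(ℝ, E) ∞ Q] in
theorem eventually_mem_domain {q : Fin (k + 1) → E} (hq : q 0 ∈ e.target)
    (hq' : e.symm (q 0) ∈ e'.source) :
    ∀ᶠ r in 𝓝 q, r 0 ∈ e.target ∧ e.symm (r 0) ∈ e'.source := by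
  have h : (e.symm.trans e').source ∈ 𝓝 (q 0) :=
    (e.symm.trans e').open_source.mem_nhds (by simp [hq, hq'])
  filter_upwards [(continuous_apply 0).continuousAt.preimage_mem_nhds h] with r hr
  simpa using hr

theorem ofCoord_jetTransition {q : Fin (k + 1) → E} (hq' : e.symm (q 0) ∈ e'.source) :
    HOTangent.ofCoord e' (jetTransition k e e' he' q) = HOTangent.ofCoord e q := by
  rw [jetTransition, HOTangent.ofCoord_coord he']
  rwa [HOTangent.proj_ofCoord]

theorem jetTransition_comp {q : Fin (k + 1) → E} (hq' : e.symm (q 0) ∈ e'.source) :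
    jetTransition k e' e'' he'' (jetTransition k e e' he' q) = jetTransition k e e'' he'' q := by
  rw [jetTransition, ofCoord_jetTransition he' hq', jetTransition]

include he

theorem contDiffAt_jetTransition {q : Fin (k + 1) → E} (hq : q 0 ∈ e.target)
    (hq' : e.symm (q 0) ∈ e'.source) : ContDiffAt ℝ ∞ (jetTransition k e e' he') q := by
  have h := HOTangent.contDiffOn_partialChart_trans (k := k) he he'
  rw [HOTangent.partialChart_trans_source] at h
  refine h.contDiffAt (IsOpen.mem_nhds ?_ ?_)
  · exact (e.symm.trans e').open_source.preimage (continuous_apply 0)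
  · simp [hq, hq']

theorem jetTransition_jet {γ : ℝ → Q} {t : ℝ} (h : SmoothNear E γ t)
    (ht : γ t ∈ e.source) (ht' : γ t ∈ e'.source) :
    jetTransition k e e' he' (jet k (e ∘ γ) t) = jet k (e' ∘ γ) t := by
  rw [jetTransition, ofCoord_jet h he ht, coord_lift_eq_jet h he' ht']

/-- Every admissible coordinate vector is the jet of a curve, namely of its Taylor polynomial read
in the chart. Identities for `jetTransition` can thus be checked on curves, where both sides are
jets of one curve in two charts, and no formula for higher derivatives of a composition is needed.
-/
theorem exists_jet_eq {q : Fin (k + 1) → E} (hq : q 0 ∈ e.target) :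
    ∃ γ : ℝ → Q, SmoothNear E γ 0 ∧ γ 0 = e.symm (q 0) ∧ jet k (e ∘ γ) 0 = q := by
  have h := smoothNear_taylorCurve he hq
  have h0 : e.symm (taylorCurve q 0) = e.symm (q 0) := by rw [taylorCurve_zero]
  refine ⟨fun t => e.symm (taylorCurve q t), h, h0, ?_⟩
  have hs : e.symm (taylorCurve q 0) ∈ e.source := by rw [h0]; exact e.map_target hq
  rw [← coord_lift_eq_jet h he hs]
  refine Eq.trans ?_ (HOTangent.coord_ofCoord_self he hq)
  simp [HOTangent.lift, HOTangent.ofCoord]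

theorem jetTransition_apply_zero {q : Fin (k + 1) → E} (hq : q 0 ∈ e.target)
    (hq' : e.symm (q 0) ∈ e'.source) : jetTransition k e e' he' q 0 = e' (e.symm (q 0)) := by
  obtain ⟨γ, h, h0, h1⟩ := exists_jet_eq he hq
  conv_lhs => rw [← h1, jetTransition_jet he he' h (h0 ▸ e.map_target hq) (h0 ▸ hq'), jet_zero]
  rw [Function.comp_apply, h0]

theorem headL_jetTransition {q : Fin (k + 2) → E} (hq : q 0 ∈ e.target)
    (hq' : e.symm (q 0) ∈ e'.source) :
    headL E k (jetTransition (k + 1) e e' he' q) = jetTransition k e e' he' (headL E k q) := by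
  obtain ⟨γ, h, h0, h1⟩ := exists_jet_eq he hq
  have hs : γ 0 ∈ e.source := h0 ▸ e.map_target hq
  rw [← h1, jetTransition_jet he he' h hs (h0 ▸ hq'), headL_jet, headL_jet,
    jetTransition_jet he he' h hs (h0 ▸ hq')]

theorem eventually_jetTransition_jet {γ : ℝ → Q} {t : ℝ} (h : SmoothNear E γ t)
    (ht : γ t ∈ e.source) (ht' : γ t ∈ e'.source) :
    ∀ᶠ s in 𝓝 t, jetTransition k e e' he' (jet k (e ∘ γ) s) = jet k (e' ∘ γ) s := by
  filter_upwards [h.eventually_nhds, h.comp_chart he ht, h.comp_chart he' ht'] with s h1 h2 h3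
  exact jetTransition_jet he he' h1 h2.1 h3.1

/-- The derivative of a change of natural coordinates along a holonomic direction. -/
theorem fderiv_jetTransition_tailL {q : Fin (k + 2) → E} (hq : q 0 ∈ e.target)
    (hq' : e.symm (q 0) ∈ e'.source) :
    fderiv ℝ (jetTransition k e e' he') (headL E k q) (tailL E k q) =
      tailL E k (jetTransition (k + 1) e e' he' q) := by
  obtain ⟨γ, h, h0, h1⟩ := exists_jet_eq he hq
  have hs : γ 0 ∈ e.source := h0 ▸ e.map_target hq
  have hs' : γ 0 ∈ e'.source := h0 ▸ hq'
  have hT := (contDiffAt_jetTransition he he' (q := headL E k q) hq hq').differentiableAt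
    (by simp)
  rw [← h1, headL_jet] at hT ⊢
  -- The curve s ↦ jet of e' ∘ γ is differentiated twice: by the chain rule through the coordinate
  -- change, and directly by shifting the jet. Uniqueness of the derivative gives the identity.
  have h2 := hT.hasFDerivAt.comp_hasDerivAt 0 (hasDerivAt_jet (h.contDiffAt_chart he hs))
  have h3 := (hasDerivAt_jet (k := k) (h.contDiffAt_chart he' hs')).congr_of_eventuallyEq
    (eventually_jetTransition_jet he he' h hs hs')
  rw [jetTransition_jet he he' h hs hs']
  exact h2.unique h3

theorem headL_fderiv_jetTransition {q : Fin (k + 2) → E} (hq : q 0 ∈ e.target)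
    (hq' : e.symm (q 0) ∈ e'.source) (w : Fin (k + 2) → E) :
    headL E k (fderiv ℝ (jetTransition (k + 1) e e' he') q w) =
      fderiv ℝ (jetTransition k e e' he') (headL E k q) (headL E k w) := by
  have h1 := ((contDiffAt_jetTransition he he' (q := headL E k q) hq hq').differentiableAt
    (by simp)).hasFDerivAt.comp q (headL E k).hasFDerivAt
  have h2 := (headL E k).hasFDerivAt.comp q
    ((contDiffAt_jetTransition he he' hq hq').differentiableAt (by simp)).hasFDerivAt
  have h3 := h2.congr_of_eventuallyEq (f₁ := jetTransition k e e' he' ∘ headL E k) (by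
    filter_upwards [eventually_mem_domain hq hq'] with r hr
    exact (headL_jetTransition he he' hr.1 hr.2).symm)
  exact DFunLike.congr_fun (h3.unique h1) w

/-- Differentiate `fderiv_jetTransition_tailL` in q; it holds near q, and the product rule creates
the second-derivative term. This is the fibre part of the coordinate change on T T^(k) Q at the
vector `tailL q`. -/
theorem tailL_fderiv_jetTransition {q : Fin (k + 2) → E} (hq : q 0 ∈ e.target)
    (hq' : e.symm (q 0) ∈ e'.source) (w : Fin (k + 2) → E) :
    tailL E k (fderiv ℝ (jetTransition (k + 1) e e' he') q w) =
      fderiv ℝ (fderiv ℝ (jetTransition k e e' he')) (headL E k q) (headL E k w) (tailL E k q) +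
        fderiv ℝ (jetTransition k e e' he') (headL E k q) (tailL E k w) := by
  have hsm := contDiffAt_jetTransition he he' (q := headL E k q) hq hq'
  have h1 := ((hsm.fderiv_right (m := ∞) (by simp)).differentiableAt
    (by simp)).hasFDerivAt.comp q (headL E k).hasFDerivAt
  have h1' := h1.clm_apply (tailL E k).hasFDerivAt
  have h2 := (tailL E k).hasFDerivAt.comp q
    ((contDiffAt_jetTransition he he' hq hq').differentiableAt (by simp)).hasFDerivAt
  have h3 := h2.congr_of_eventuallyEq
    (f₁ := fun q => fderiv ℝ (jetTransition k e e' he') (headL E k q) (tailL E k q)) (by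
    filter_upwards [eventually_mem_domain hq hq'] with r hr
    exact fderiv_jetTransition_tailL he he' hr.1 hr.2)
  refine (DFunLike.congr_fun (h3.unique h1') w).trans ?_
  exact add_comm _ _

end Transition

end Jets

/-! ### The canonical immersion in natural coordinates -/

section LagrangianInCharts

variable {E : Type*} [NormedAddCommGroup E] [NormedSpace ℝ E]
  {Q : Type*} [TopologicalSpace Q] [ChartedSpace E Q] [IsManifold 𝓘(ℝ, E) ∞ Q] {k m : ℕ}

variable (E) in
/-- The preferred chart of `Q` at `x` belongs to the maximal atlas. -/
theorem chart_mem (x : Q) : chartAt E x ∈ IsManifold.maximalAtlas 𝓘(ℝ, E) ∞ Q :=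
  IsManifold.chart_mem_maximalAtlas x

/-- Natural coordinates in the preferred chart of `T^(k) Q` at `x`. -/
theorem chartAt_hotangent_apply (x y : HOTangent E Q k) :
    chartAt (Fin (k + 1) → E) x y =
      HOTangent.coord (chartAt E x.proj) (chart_mem E _) y := rfl

theorem transition_hotangent (x y : HOTangent E Q k) :
    transition (Fin (k + 1) → E) x y =
      jetTransition k (chartAt E x.proj) (chartAt E y.proj) (chart_mem E _) := rfl

theorem coord_zero {e : OpenPartialHomeomorph Q E} (he : e ∈ IsManifold.maximalAtlas 𝓘(ℝ, E) ∞ Q)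
    {x : HOTangent E Q k} (hx : x.proj ∈ e.source) : HOTangent.coord e he x 0 = e x.proj := by
  induction x using Quotient.inductionOn with
  | h γ =>
    change HOTangent.coord e he (HOTangent.mk k γ) 0 = e (γ.toFun 0)
    rw [HOTangent.coord_mk he hx]
    simp

theorem coord_zero_mem {e e' : OpenPartialHomeomorph Q E}
    (he : e ∈ IsManifold.maximalAtlas 𝓘(ℝ, E) ∞ Q)
    {x : HOTangent E Q k} (hx : x.proj ∈ e.source) (hx' : x.proj ∈ e'.source) :
    HOTangent.coord e he x 0 ∈ e.target ∧ e.symm (HOTangent.coord e he x 0) ∈ e'.source := by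
  rw [coord_zero he hx, e.left_inv hx]
  exact ⟨e.map_source hx, hx'⟩

theorem jetTransition_coord {e e' : OpenPartialHomeomorph Q E}
    (he : e ∈ IsManifold.maximalAtlas 𝓘(ℝ, E) ∞ Q)
    (he' : e' ∈ IsManifold.maximalAtlas 𝓘(ℝ, E) ∞ Q)
    {x : HOTangent E Q k} (hx : x.proj ∈ e.source) :
    jetTransition k e e' he' (HOTangent.coord e he x) = HOTangent.coord e' he' x := by
  rw [jetTransition, HOTangent.ofCoord_coord he hx]

/-- The canonical immersion in natural coordinates. -/
theorem canonicalImmersion_eq (x : HOTangent E Q (k + 1)) :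
    HOTangent.canonicalImmersion E Q k x =
      ⟨HOTangent.ofCoord (chartAt E x.proj)
          (headL E k (HOTangent.coord (chartAt E x.proj) (chart_mem E _) x)),
        tailL E k (HOTangent.coord (chartAt E x.proj) (chart_mem E _) x)⟩ := by
  induction x using Quotient.inductionOn with
  | h γ =>
    have h0 := HOTangent.coord_mk (k := k + 1) (chart_mem E (γ.toFun 0)) (γ := γ)
      (mem_chart_source E _)
    change (⟨HOTangent.lift E k γ.toFun 0, _⟩ : TangentBundle _ _) =
      ⟨HOTangent.ofCoord (chartAt E (γ.toFun 0)) (headL E k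
          (HOTangent.coord (chartAt E (γ.toFun 0)) (chart_mem E _) (HOTangent.mk (k + 1) γ))),
        tailL E k (HOTangent.coord (chartAt E (γ.toFun 0)) (chart_mem E _)
          (HOTangent.mk (k + 1) γ))⟩
    rw [h0]
    refine Bundle.TotalSpace.ext ?_ (heq_of_eq ?_)
    · exact (ofCoord_jet γ.smooth (chart_mem E _) (mem_chart_source E _)).symm
    · rw [HOTangent.mfderiv_lift γ.smooth]
      rfl

theorem proj_canonicalImmersion_proj (x : HOTangent E Q (k + 1)) :
    (HOTangent.canonicalImmersion E Q k x).proj.proj = x.proj := by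
  rw [canonicalImmersion_eq, HOTangent.proj_ofCoord]
  exact (congrArg _ (coord_zero (chart_mem E _) (mem_chart_source E _))).trans
    ((chartAt E x.proj).left_inv (mem_chart_source E _))

theorem coord_canonicalImmersion_proj {e : OpenPartialHomeomorph Q E}
    (he : e ∈ IsManifold.maximalAtlas 𝓘(ℝ, E) ∞ Q) {x : HOTangent E Q (k + 1)}
    (hx : x.proj ∈ e.source) :
    HOTangent.coord e he (HOTangent.canonicalImmersion E Q k x).proj =
      headL E k (HOTangent.coord e he x) := by
  obtain ⟨h1, h2⟩ := coord_zero_mem (chart_mem E x.proj) (mem_chart_source E _) hx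
  rw [canonicalImmersion_eq, ← jetTransition_coord (chart_mem E x.proj) he (mem_chart_source E _),
    headL_jetTransition (chart_mem E _) he h1 h2]
  rfl

theorem canonicalImmersion_lift {γ : ℝ → Q} {t : ℝ} (h : SmoothNear E γ t) :
    HOTangent.canonicalImmersion E Q k (HOTangent.lift E (k + 1) γ t) =
      ⟨HOTangent.lift E k γ t, tailL E k (jet (k + 1) (chartAt E (γ t) ∘ γ) t)⟩ := by
  have hs := mem_chart_source E (γ t)
  rw [canonicalImmersion_eq]
  -- The chart is the one at the projection of the lift, which equals `γ t` only propositionally.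
  -- Generalizing the base point allows substitution under the dependent chart proof; the same
  -- device recurs below.
  have key : ∀ y, y = γ t → (⟨HOTangent.ofCoord (chartAt E y)
          (headL E k (HOTangent.coord (chartAt E y) (chart_mem E _) (HOTangent.lift E (k + 1) γ t))),
        tailL E k (HOTangent.coord (chartAt E y) (chart_mem E _) (HOTangent.lift E (k + 1) γ t))⟩ :
          TangentBundle 𝓘(ℝ, Fin (k + 1) → E) (HOTangent E Q k)) =
      ⟨HOTangent.lift E k γ t, tailL E k (jet (k + 1) (chartAt E (γ t) ∘ γ) t)⟩ := by
    rintro _ rfl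
    rw [coord_lift_eq_jet h (chart_mem E _) hs, headL_jet, ofCoord_jet h (chart_mem E _) hs]
  exact key _ (HOTangent.proj_lift γ t)

theorem eq_of_headL_eq_of_tailL_eq {q r : Fin (k + 2) → E} (h : headL E k q = headL E k r)
    (h' : tailL E k q = tailL E k r) : q = r := by
  funext j
  refine Fin.cases ?_ (fun i => ?_) j
  · exact congrFun h 0
  · exact congrFun h' i

/-- Head and tail together contain every natural coordinate. Consequently the point x in the
definition of Σ_L is determined by the base point of μ. -/
theorem canonicalImmersion_injective :
    Function.Injective (HOTangent.canonicalImmersion E Q k) := by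
  intro x y hxy
  have hp : x.proj = y.proj := by
    rw [← proj_canonicalImmersion_proj, hxy, proj_canonicalImmersion_proj]
  have hy : y.proj ∈ (chartAt E x.proj).source := hp ▸ mem_chart_source E x.proj
  have h1 := coord_canonicalImmersion_proj (chart_mem E x.proj) (mem_chart_source E x.proj)
  have h2 := coord_canonicalImmersion_proj (chart_mem E x.proj) hy
  have h3 : tailL E k (HOTangent.coord (chartAt E x.proj) (chart_mem E _) x) =
      tailL E k (HOTangent.coord (chartAt E x.proj) (chart_mem E _) y) := by
    have a1 := canonicalImmersion_eq x
    have a2 := canonicalImmersion_eq y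
    rw [hxy, a2] at a1
    have a3 := eq_of_heq (Bundle.TotalSpace.mk.inj a1).2
    refine a3.symm.trans ?_
    have : ∀ z (hz : z = x.proj), tailL E k (HOTangent.coord (chartAt E z) (chart_mem E _) y) =
        tailL E k (HOTangent.coord (chartAt E x.proj) (chart_mem E _) y) := by
      rintro _ rfl; rfl
    exact this _ hp.symm
  have h4 := eq_of_headL_eq_of_tailL_eq (h1.symm.trans ((by rw [hxy]; exact h2))) h3
  rw [← HOTangent.ofCoord_coord (chart_mem E x.proj) (mem_chart_source E x.proj), h4,
    HOTangent.ofCoord_coord _ hy]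

end LagrangianInCharts

/-! ### Smoothness and differential of the canonical immersion -/

section LagrangianInCharts

variable {E : Type*} [NormedAddCommGroup E] [NormedSpace ℝ E]
  {Q : Type*} [TopologicalSpace Q] [ChartedSpace E Q] [IsManifold 𝓘(ℝ, E) ∞ Q] {k m : ℕ}

theorem canonicalImmersion_snd (x : HOTangent E Q (k + 1)) :
    (HOTangent.canonicalImmersion E Q k x).snd =
      tailL E k (HOTangent.coord
        (chartAt E (HOTangent.canonicalImmersion E Q k x).proj.proj) (chart_mem E _) x) := by
  have key : ∀ y, y = x.proj → (HOTangent.canonicalImmersion E Q k x).snd =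
      tailL E k (HOTangent.coord (chartAt E y) (chart_mem E _) x) := by
    rintro _ rfl
    rw [canonicalImmersion_eq]
  exact key _ (proj_canonicalImmersion_proj x)

/-- Holonomic vectors are preserved by coordinate changes: by `fderiv_jetTransition_tailL`, the
fibre coordinate of j(x) is the shifted coordinate vector in every chart, not only in the one at x.
-/
theorem tangentCoordChange_canonicalImmersion_snd {x : HOTangent E Q (k + 1)}
    {y : HOTangent E Q k} (hx : x.proj ∈ (chartAt E y.proj).source) :
    tangentCoordChange 𝓘(ℝ, Fin (k + 1) → E) (HOTangent.canonicalImmersion E Q k x).proj y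
        (HOTangent.canonicalImmersion E Q k x).proj (HOTangent.canonicalImmersion E Q k x).snd =
      tailL E k (HOTangent.coord (chartAt E y.proj) (chart_mem E _) x) := by
  have hp := proj_canonicalImmersion_proj x
  have hx' : x.proj ∈ (chartAt E (HOTangent.canonicalImmersion E Q k x).proj.proj).source := by
    rw [hp]; exact mem_chart_source E _
  obtain ⟨h1, h2⟩ := coord_zero_mem (chart_mem E _) hx' hx
  rw [tangentCoordChange_eq_fderiv, canonicalImmersion_snd, transition_hotangent,
    chartAt_hotangent_apply, coord_canonicalImmersion_proj _ hx',
    fderiv_jetTransition_tailL (chart_mem E _) _ h1 h2, jetTransition_coord (chart_mem E _) _ hx']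

theorem contMDiffAt_coord {e : OpenPartialHomeomorph Q E}
    (he : e ∈ IsManifold.maximalAtlas 𝓘(ℝ, E) ∞ Q) {x : HOTangent E Q k}
    (hx : x.proj ∈ e.source) :
    ContMDiffAt (jetModel E k) 𝓘(ℝ, Fin (k + 1) → E) ∞ (HOTangent.coord e he) x := by
  have h1 := contMDiffAt_of_mem_maximalAtlas (I := jetModel E k) (n := ∞)
    (IsManifold.chart_mem_maximalAtlas x) (mem_chart_source (Fin (k + 1) → E) x)
  obtain ⟨a, b⟩ := coord_zero_mem (chart_mem E x.proj) (mem_chart_source E _) hx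
  have h2 := (contDiffAt_jetTransition (chart_mem E x.proj) he a b).contMDiffAt.comp x h1
  refine h2.congr_of_eventuallyEq ?_
  filter_upwards [chart_source_mem_nhds (Fin (k + 1) → E) x] with y hy
  exact (jetTransition_coord (chart_mem E _) he hy).symm

theorem contMDiffAt_ofCoord {e : OpenPartialHomeomorph Q E}
    (he : e ∈ IsManifold.maximalAtlas 𝓘(ℝ, E) ∞ Q) {q : Fin (k + 1) → E} (hq : q 0 ∈ e.target) :
    ContMDiffAt 𝓘(ℝ, Fin (k + 1) → E) (jetModel E k) ∞
      (HOTangent.ofCoord e : (Fin (k + 1) → E) → HOTangent E Q k) q := by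
  set x : HOTangent E Q k := HOTangent.ofCoord e q with hx
  have hx' : e.symm (q 0) ∈ (chartAt E x.proj).source := by
    rw [hx, HOTangent.proj_ofCoord]; exact mem_chart_source E _
  have h1 := (contDiffAt_jetTransition he (chart_mem E x.proj) hq hx').contMDiffAt
  have h2 := contMDiffAt_symm_of_mem_maximalAtlas (I := jetModel E k) (n := ∞)
    (IsManifold.chart_mem_maximalAtlas x) (x := jetTransition k e (chartAt E x.proj) (chart_mem E _) q)
    ((chartAt (Fin (k + 1) → E) x).map_source (mem_chart_source (Fin (k + 1) → E) x))
  refine (h2.comp q h1).congr_of_eventuallyEq ?_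
  filter_upwards [eventually_mem_domain hq hx'] with r hr
  exact (ofCoord_jetTransition (chart_mem E _) hr.2).symm

/-- In a single chart of `Q` around the point, base and fibre of j are the linear functions `headL`
and `tailL` of the natural coordinates. -/
theorem contMDiffAt_canonicalImmersion (x : HOTangent E Q (k + 1)) :
    ContMDiffAt (jetModel E (k + 1)) (jetModel E k).tangent ∞
      (HOTangent.canonicalImmersion E Q k) x := by
  set y := (HOTangent.canonicalImmersion E Q k x).proj with hy
  have hx : x.proj ∈ (chartAt E y.proj).source := by
    rw [proj_canonicalImmersion_proj]; exact mem_chart_source E _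
  have hnear : ∀ᶠ z : HOTangent E Q (k + 1) in 𝓝 x, z.proj ∈ (chartAt E y.proj).source := by
    have h : ContinuousAt (HOTangent.proj : HOTangent E Q (k + 1) → Q) x := by
      have h1 := contMDiffAt_coord (chart_mem E x.proj) (mem_chart_source E x.proj) |>.continuousAt
      have h2 := ((continuous_apply (0 : Fin (k + 2))).continuousAt.comp h1)
      have h3 : ContinuousAt (chartAt E x.proj).symm
          (HOTangent.coord (chartAt E x.proj) (chart_mem E _) x 0) :=
        (chartAt E x.proj).symm.continuousAt
          (coord_zero_mem (chart_mem E _) (mem_chart_source E x.proj) (mem_chart_source E x.proj)).1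
      refine (ContinuousAt.comp (x := x) h3 h2).congr ?_
      filter_upwards [chart_source_mem_nhds (Fin (k + 2) → E) x] with z hz
      exact (congrArg _ (coord_zero (chart_mem E _) hz)).trans ((chartAt E x.proj).left_inv hz)
    exact h.preimage_mem_nhds ((chartAt E y.proj).open_source.mem_nhds hx)
  have hc := contMDiffAt_coord (chart_mem E y.proj) hx
  refine Bundle.contMDiffAt_totalSpace.2 ⟨?_, ?_⟩
  · have h1 := (headL E k).contDiff.contMDiff.contMDiffAt.comp x hc
    have h2 := contMDiffAt_ofCoord (chart_mem E y.proj)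
      (q := headL E k (HOTangent.coord (chartAt E y.proj) (chart_mem E _) x))
      (coord_zero_mem (chart_mem E _) hx hx).1
    refine (h2.comp x h1).congr_of_eventuallyEq ?_
    filter_upwards [hnear] with z hz
    rw [Function.comp_apply, Function.comp_apply, ← coord_canonicalImmersion_proj _ hz,
      HOTangent.ofCoord_coord]
    rwa [proj_canonicalImmersion_proj z]
  · refine ((tailL E k).contDiff.contMDiff.contMDiffAt.comp x hc).congr_of_eventuallyEq ?_
    filter_upwards [hnear] with z hz
    exact tangentCoordChange_canonicalImmersion_snd hz

/-- The canonical immersion is the linear map `(headL, tailL)` in natural coordinates. -/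
theorem mfderiv_canonicalImmersion (x : HOTangent E Q (k + 1)) (w : Fin (k + 2) → E) :
    mfderiv (jetModel E (k + 1)) (jetModel E k).tangent (HOTangent.canonicalImmersion E Q k) x w =
      ((headL E k w, tailL E k w) : (Fin (k + 1) → E) × (Fin (k + 1) → E)) := by
  have h := ((contMDiffAt_canonicalImmersion x).mdifferentiableAt (by simp)).hasMFDerivAt.2
  simp only [writtenInExtChartAt, extChartAt, mfld_simps] at h
  set y := (HOTangent.canonicalImmersion E Q k x).proj with hy
  have hq := (coord_zero_mem (chart_mem E x.proj) (mem_chart_source E x.proj)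
    (mem_chart_source E x.proj))
  -- The preferred charts at x and at j(x) come from the preferred chart of `Q` at the same point,
  -- so near x the local expression of j is exactly linear and equals its own differential.
  have hev : ∀ᶠ q in 𝓝 (HOTangent.coord (chartAt E x.proj) (chart_mem E _) x),
      ((headL E k q, tailL E k q) : (Fin (k + 1) → E) × (Fin (k + 1) → E)) =
      extChartAt (jetModel E k).tangent (HOTangent.canonicalImmersion E Q k x)
        (HOTangent.canonicalImmersion E Q k (HOTangent.ofCoord (chartAt E x.proj) q)) := by
    filter_upwards [eventually_mem_domain hq.1 hq.2] with q hq
    have h1 : ∀ z, z = x.proj → HOTangent.coord (chartAt E z) (chart_mem E _)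
        (HOTangent.ofCoord (chartAt E x.proj) q) = q := by
      rintro _ rfl
      exact HOTangent.coord_ofCoord_self _ hq.1
    have h2 := h1 y.proj (proj_canonicalImmersion_proj x)
    have h3 : (HOTangent.ofCoord (chartAt E x.proj) q : HOTangent E Q (k + 1)).proj ∈
        (chartAt E y.proj).source := by
      rw [HOTangent.proj_ofCoord, proj_canonicalImmersion_proj]; exact hq.2
    have h4 := tangentCoordChange_canonicalImmersion_snd h3
    have h5 := coord_canonicalImmersion_proj (chart_mem E y.proj) h3
    rw [h2] at h4 h5
    exact Prod.ext h5.symm h4.symm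
  have h6 : HasFDerivAt
      (fun q => ((headL E k q, tailL E k q) : (Fin (k + 1) → E) × (Fin (k + 1) → E)))
      (show (Fin (k + 2) → E) →L[ℝ] (Fin (k + 1) → E) × (Fin (k + 1) → E) from
        mfderiv (jetModel E (k + 1)) (jetModel E k).tangent (HOTangent.canonicalImmersion E Q k) x)
      (HOTangent.coord (chartAt E x.proj) (chart_mem E _) x) :=
    (hasFDerivWithinAt_univ.1 h).congr_of_eventuallyEq hev
  exact congrArg (fun f : (Fin (k + 2) → E) →L[ℝ] (Fin (k + 1) → E) × (Fin (k + 1) → E) => f w)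
    (h6.unique ((headL E k).prod (tailL E k)).hasFDerivAt)

end LagrangianInCharts

/-! ### Σ_L, N_L and the generalized momentum equations in charts -/

section LagrangianInCharts

variable {E : Type*} [NormedAddCommGroup E] [NormedSpace ℝ E]
  {Q : Type*} [TopologicalSpace Q] [ChartedSpace E Q] [IsManifold 𝓘(ℝ, E) ∞ Q] {k m : ℕ}

/-- The Lagrangian in the natural coordinates induced by `e`. -/
def localLagrangian (L : HOTangent E Q k → ℝ) (e : OpenPartialHomeomorph Q E)
    (q : Fin (k + 1) → E) : ℝ := L (HOTangent.ofCoord e q)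

theorem contDiffAt_localLagrangian {L : HOTangent E Q k → ℝ}
    (hL : ContMDiff (jetModel E k) 𝓘(ℝ, ℝ) ∞ L) {e : OpenPartialHomeomorph Q E}
    (he : e ∈ IsManifold.maximalAtlas 𝓘(ℝ, E) ∞ Q) {q : Fin (k + 1) → E} (hq : q 0 ∈ e.target) :
    ContDiffAt ℝ ∞ (localLagrangian L e) q :=
  contMDiffAt_iff_contDiffAt.1 (hL.contMDiffAt.comp q (contMDiffAt_ofCoord he hq))

theorem fderiv_localLagrangian {L : HOTangent E Q k → ℝ}
    (hL : ContMDiff (jetModel E k) 𝓘(ℝ, ℝ) ∞ L) {e e' : OpenPartialHomeomorph Q E}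
    (he : e ∈ IsManifold.maximalAtlas 𝓘(ℝ, E) ∞ Q)
    (he' : e' ∈ IsManifold.maximalAtlas 𝓘(ℝ, E) ∞ Q) {q : Fin (k + 1) → E}
    (hq : q 0 ∈ e.target) (hq' : e.symm (q 0) ∈ e'.source) :
    fderiv ℝ (localLagrangian L e) q =
      fderiv ℝ (localLagrangian L e') (jetTransition k e e' he' q) ∘L
        fderiv ℝ (jetTransition k e e' he') q := by
  have h0 : jetTransition k e e' he' q 0 ∈ e'.target := by
    rw [jetTransition_apply_zero he he' hq hq']; exact e'.map_source hq'
  have h1 := ((contDiffAt_localLagrangian hL he' h0).differentiableAt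
    (by simp)).hasFDerivAt.comp q
    ((contDiffAt_jetTransition he he' hq hq').differentiableAt (by simp)).hasFDerivAt
  refine (h1.congr_of_eventuallyEq ?_).fderiv
  filter_upwards [eventually_mem_domain hq hq'] with r hr
  exact congrArg L (ofCoord_jetTransition he' hr.2).symm

theorem mfderiv_lagrangian {L : HOTangent E Q k → ℝ}
    (hL : ContMDiff (jetModel E k) 𝓘(ℝ, ℝ) ∞ L) (x : HOTangent E Q k) (w : Fin (k + 1) → E) :
    mfderiv (jetModel E k) 𝓘(ℝ, ℝ) L x w =
      fderiv ℝ (localLagrangian L (chartAt E x.proj))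
        (HOTangent.coord (chartAt E x.proj) (chart_mem E _) x) w := by
  have h := ((hL.contMDiffAt (x := x)).mdifferentiableAt (by simp)).hasMFDerivAt.2
  simp only [writtenInExtChartAt, extChartAt, mfld_simps] at h
  have h1 : HasFDerivAt (localLagrangian L (chartAt E x.proj))
      (show (Fin (k + 1) → E) →L[ℝ] ℝ from mfderiv (jetModel E k) 𝓘(ℝ, ℝ) L x)
      (HOTangent.coord (chartAt E x.proj) (chart_mem E _) x) := hasFDerivWithinAt_univ.1 h
  rw [h1.fderiv]
  rfl

/-- By injectivity of j the given x is the only possible witness, and both differentials in the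
condition are known in the chart at x. -/
theorem mem_lagrangianSubmanifold_iff {L : HOTangent E Q (m + 1) → ℝ}
    (hL : ContMDiff (jetModel E (m + 1)) 𝓘(ℝ, ℝ) ∞ L) {μ : CotangentTangent E Q m}
    {x : HOTangent E Q (m + 1)} (hμ : μ.proj = HOTangent.canonicalImmersion E Q m x) :
    μ ∈ lagrangianSubmanifold L ↔ ∀ w : Fin (m + 2) → E,
      (show (Fin (m + 1) → E) × (Fin (m + 1) → E) →L[ℝ] ℝ from μ.snd)
          (headL E m w, tailL E m w) =
        fderiv ℝ (localLagrangian L (chartAt E x.proj))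
          (HOTangent.coord (chartAt E x.proj) (chart_mem E _) x) w := by
  constructor
  · rintro ⟨x', ν, rfl, h⟩ w
    obtain rfl := canonicalImmersion_injective hμ
    rw [← mfderiv_lagrangian hL, ← h w]
    exact congrArg ν (mfderiv_canonicalImmersion _ w).symm
  · intro h
    obtain ⟨b, ν⟩ := μ
    obtain rfl : b = _ := hμ
    refine ⟨x, ν, rfl, fun w => ?_⟩
    refine (congrArg ν (mfderiv_canonicalImmersion x w)).trans ?_
    exact (h w).trans (mfderiv_lagrangian hL x w).symm

/-- The momentum coordinates of `p ∈ T^* T^(m) Q` induced by a chart `e` of `Q`. -/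
def momentumAt (e : OpenPartialHomeomorph Q E) (he : e ∈ IsManifold.maximalAtlas 𝓘(ℝ, E) ∞ Q)
    (p : MomentumSpace E Q m) : (Fin (m + 1) → E) →L[ℝ] ℝ :=
  (show (Fin (m + 1) → E) →L[ℝ] ℝ from p.snd) ∘L
    fderiv ℝ (jetTransition m e (chartAt E p.proj.proj) (chart_mem E _))
      (HOTangent.coord e he p.proj)

theorem momentumIn_eq_momentumAt (x : HOTangent E Q m) (p : MomentumSpace E Q m) :
    momentumIn x p = momentumAt (chartAt E x.proj) (chart_mem E _) p := by
  unfold momentumIn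
  rw [tangentCoordChange_eq_fderiv]
  rfl

theorem momentumAt_eq_comp {e e' : OpenPartialHomeomorph Q E}
    (he : e ∈ IsManifold.maximalAtlas 𝓘(ℝ, E) ∞ Q)
    (he' : e' ∈ IsManifold.maximalAtlas 𝓘(ℝ, E) ∞ Q) {p : MomentumSpace E Q m}
    (hp : p.proj.proj ∈ e.source) (hp' : p.proj.proj ∈ e'.source) :
    momentumAt e he p = momentumAt e' he' p ∘L
      fderiv ℝ (jetTransition m e e' he') (HOTangent.coord e he p.proj) := by
  have hs := mem_chart_source E p.proj.proj
  obtain ⟨h1, h2⟩ := coord_zero_mem he hp hp'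
  obtain ⟨h3, h4⟩ := coord_zero_mem he' hp' hs
  have a1 := ((contDiffAt_jetTransition he he' h1 h2).differentiableAt (by simp)).hasFDerivAt
  have a2 := ((contDiffAt_jetTransition he' (chart_mem E p.proj.proj) h3 h4).differentiableAt
    (by simp)).hasFDerivAt
  have hc := jetTransition_coord he he' hp
  rw [← hc] at a2
  have a3 := (a2.comp _ a1).congr_of_eventuallyEq
    (f₁ := jetTransition m e (chartAt E p.proj.proj) (chart_mem E _)) (by
    filter_upwards [eventually_mem_domain h1 h2] with r hr
    exact (jetTransition_comp he' _ hr.2).symm)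
  unfold momentumAt
  rw [a3.fderiv, hc, ContinuousLinearMap.comp_assoc]

/-- The generalized momentum equations at `t`, in natural coordinates. -/
def MomentumEquation (L : HOTangent E Q (m + 1) → ℝ) (e : OpenPartialHomeomorph Q E) (γ : ℝ → Q)
    (P : ℝ → (Fin (m + 1) → E) →L[ℝ] ℝ) (t : ℝ) : Prop :=
  ∀ w : Fin (m + 2) → E, deriv P t (headL E m w) + P t (tailL E m w) =
    fderiv ℝ (localLagrangian L e) (jet (m + 1) (e ∘ γ) t) w

/-- The generalized momentum equations do not depend on the chart. -/
theorem MomentumEquation.change_chart {L : HOTangent E Q (m + 1) → ℝ}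
    (hL : ContMDiff (jetModel E (m + 1)) 𝓘(ℝ, ℝ) ∞ L) {e e' : OpenPartialHomeomorph Q E}
    (he : e ∈ IsManifold.maximalAtlas 𝓘(ℝ, E) ∞ Q)
    (he' : e' ∈ IsManifold.maximalAtlas 𝓘(ℝ, E) ∞ Q) {γ : ℝ → Q} {t : ℝ}
    (hγ : SmoothNear E γ t) (ht : γ t ∈ e.source) (ht' : γ t ∈ e'.source)
    {P P' : ℝ → (Fin (m + 1) → E) →L[ℝ] ℝ} (hP' : DifferentiableAt ℝ P' t)
    (hP : P =ᶠ[𝓝 t] fun s => P' s ∘L fderiv ℝ (jetTransition m e e' he') (jet m (e ∘ γ) s))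
    (h : MomentumEquation L e' γ P' t) : MomentumEquation L e γ P t := by
  intro w
  set q := jet (m + 1) (e ∘ γ) t with hq
  have hq0 : q 0 = e (γ t) := jet_zero _ _ _
  have h1 : q 0 ∈ e.target := by rw [hq0]; exact e.map_source ht
  have h2 : e.symm (q 0) ∈ e'.source := by rw [hq0, e.left_inv ht]; exact ht'
  have hsm := contDiffAt_jetTransition he he' (q := headL E m q) h1 h2
  have hd1 := ((hsm.fderiv_right (m := ∞) (by simp)).differentiableAt
    (by simp)).hasFDerivAt.comp_hasDerivAt t (hasDerivAt_jet (hγ.contDiffAt_chart he ht))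
  have hd2 := (hP'.hasDerivAt.clm_comp hd1).congr_of_eventuallyEq hP
  -- The equation in `e'` is tested on the image of `w`. One second-derivative term comes from the
  -- tail of that image, the other from differentiating the Jacobian in `hP` along the lift; they
  -- differ only in the order of arguments.
  have hsymm := (hsm.isSymmSndFDerivAt
      (by simpa using (ENat.LEInfty.out : (2 : WithTop ℕ∞) ≤ ∞))) (headL E m w) (tailL E m q)
  have key := h (fderiv ℝ (jetTransition (m + 1) e e' he') q w)
  rw [headL_fderiv_jetTransition he he' h1 h2, tailL_fderiv_jetTransition he he' h1 h2, hsymm,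
    map_add] at key
  rw [hd2.deriv, hP.self_of_nhds, fderiv_localLagrangian hL he he' h1 h2,
    jetTransition_jet he he' hγ ht ht']
  exact (add_assoc _ _ _).trans key

theorem contDiffAt_momentumAt {σ : ℝ → MomentumSpace E Q m} {t : ℝ}
    (h : ContMDiffAt 𝓘(ℝ, ℝ) (cotangentModel (jetModel E m)) ∞ σ t)
    {γ : ℝ → Q} (hγ : SmoothNear E γ t) (hσ : ∀ᶠ s in 𝓝 t, (σ s).proj = HOTangent.lift E m γ s)
    {e : OpenPartialHomeomorph Q E} (he : e ∈ IsManifold.maximalAtlas 𝓘(ℝ, E) ∞ Q)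
    (ht : γ t ∈ e.source) : ContDiffAt ℝ ∞ (fun s => momentumAt e he (σ s)) t := by
  set e' := chartAt E (σ t).proj.proj with he'
  have ht' : γ t ∈ e'.source := by
    rw [he', hσ.self_of_nhds, HOTangent.proj_lift]; exact mem_chart_source E _
  have h1 := (contMDiffAt_cotangent_iff.1 h).2
  have h2 := (contDiffAt_jetTransition he (chart_mem E (σ t).proj.proj) (q := jet m (e ∘ γ) t)
    (by rw [jet_zero]; exact e.map_source ht)
    (by rw [jet_zero, Function.comp_apply, e.left_inv ht]; exact ht')).fderiv_right (m := ∞)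
      (by simp)
  refine (h1.clm_comp (h2.comp t (contDiffAt_jet (hγ.contDiffAt_chart he ht)))
    ).congr_of_eventuallyEq ?_
  filter_upwards [hσ, hγ.eventually_nhds, hγ.comp_chart he ht,
    hγ.comp_chart (chart_mem E _) ht'] with s h3 h4 h5 h6
  have h7 : (σ s).proj.proj = γ s := by rw [h3, HOTangent.proj_lift]
  rw [momentumAt_eq_comp he (chart_mem E (σ t).proj.proj) (h7 ▸ h5.1) (h7 ▸ h6.1), h3,
    coord_lift_eq_jet h4 he h5.1, momentumIn_eq_momentumAt]
  rfl

/-- α covers the tangent map of the bundle projection, so the base point of α(dσ/dt) is the velocity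
of the base curve, here the velocity of a lift. -/
theorem tulczyjewAlpha_velocity_proj {σ : ℝ → MomentumSpace E Q m} {t : ℝ}
    (h : ContMDiffAt 𝓘(ℝ, ℝ) (cotangentModel (jetModel E m)) ∞ σ t)
    {γ : ℝ → Q} (hγ : SmoothNear E γ t) (hσ : ∀ᶠ s in 𝓝 t, (σ s).proj = HOTangent.lift E m γ s) :
    (tulczyjewAlpha (jetModel E m) (HOTangent E Q m) (velocity σ t)).proj =
      HOTangent.canonicalImmersion E Q m (HOTangent.lift E (m + 1) γ t) := by
  have h1 := (hasDerivAt_cotangent (h.mdifferentiableAt (by simp))).1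
  rw [canonicalImmersion_lift hγ]
  refine Bundle.TotalSpace.ext hσ.self_of_nhds (heq_of_eq ?_)
  have key : ∀ y, y = γ t → ∀ v, HasDerivAt (fun s => HOTangent.coord (chartAt E y)
      (chart_mem E _) (σ s).proj) v t → v = tailL E m (jet (m + 1) (chartAt E (γ t) ∘ γ) t) := by
    rintro _ rfl v hv
    have hs := mem_chart_source E (γ t)
    refine hv.unique ((hasDerivAt_jet (hγ.contDiffAt_chart (chart_mem E (γ t)) hs)
      ).congr_of_eventuallyEq ?_)
    filter_upwards [hσ, hγ.eventually_nhds, hγ.comp_chart (chart_mem E _) hs] with s h3 h4 h5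
    rw [h3, coord_lift_eq_jet h4 _ h5.1]
  exact key (σ t).proj.proj (by rw [hσ.self_of_nhds, HOTangent.proj_lift]) _ h1

/-- In the preferred chart at the base point of `σ t`, the components of the velocity are
derivatives of the coordinates, and membership in Σ_L reads as the momentum equation. Chart
independence transports this to every `e`. -/
theorem velocity_mem_dynamicsSubmanifold_iff {L : HOTangent E Q (m + 1) → ℝ}
    (hL : ContMDiff (jetModel E (m + 1)) 𝓘(ℝ, ℝ) ∞ L) {σ : ℝ → MomentumSpace E Q m} {t : ℝ}
    (h : ContMDiffAt 𝓘(ℝ, ℝ) (cotangentModel (jetModel E m)) ∞ σ t)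
    {γ : ℝ → Q} (hγ : SmoothNear E γ t) (hσ : ∀ᶠ s in 𝓝 t, (σ s).proj = HOTangent.lift E m γ s)
    {e : OpenPartialHomeomorph Q E} (he : e ∈ IsManifold.maximalAtlas 𝓘(ℝ, E) ∞ Q)
    (ht : γ t ∈ e.source) :
    velocity σ t ∈ dynamicsSubmanifold L ↔
      MomentumEquation L e γ (fun s => momentumAt e he (σ s)) t := by
  have hp : (σ t).proj.proj = γ t := by rw [hσ.self_of_nhds, HOTangent.proj_lift]
  set e' := chartAt E (σ t).proj.proj with he'
  have ht' : γ t ∈ e'.source := by rw [he', hp]; exact mem_chart_source E _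
  have h1 : velocity σ t ∈ dynamicsSubmanifold L ↔
      MomentumEquation L e' γ (fun s => momentumAt e' (chart_mem E _) (σ s)) t := by
    refine (mem_lagrangianSubmanifold_iff hL (tulczyjewAlpha_velocity_proj h hγ hσ)).trans ?_
    refine forall_congr' fun w => ?_
    have hd := (hasDerivAt_cotangent (h.mdifferentiableAt (by simp))).2
    have hself := momentumIn_self (σ t)
    have key : ∀ y, y = (σ t).proj.proj → fderiv ℝ (localLagrangian L (chartAt E y))
        (HOTangent.coord (chartAt E y) (chart_mem E _) (HOTangent.lift E (m + 1) γ t)) w =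
        fderiv ℝ (localLagrangian L e') (jet (m + 1) (e' ∘ γ) t) w := by
      rintro _ rfl
      rw [coord_lift_eq_jet hγ _ ht']
    rw [key _ ((HOTangent.proj_lift γ t).trans hp.symm)]
    have hl : (show (Fin (m + 1) → E) × (Fin (m + 1) → E) →L[ℝ] ℝ from
        (tulczyjewAlpha (jetModel E m) (HOTangent E Q m) (velocity σ t)).snd)
          (headL E m w, tailL E m w) =
        deriv (fun s => momentumAt e' (chart_mem E _) (σ s)) t (headL E m w) +
          momentumAt e' (chart_mem E _) (σ t) (tailL E m w) := by
      have hd' : HasDerivAt (fun s => momentumAt e' (chart_mem E _) (σ s)) _ t :=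
        hd.congr_of_eventuallyEq
          (Eventually.of_forall fun s => (momentumIn_eq_momentumAt _ (σ s)).symm)
      rw [hd'.deriv, ← momentumIn_eq_momentumAt, hself]
      rfl
    rw [hl]
  have hswap : ∀ {a b : OpenPartialHomeomorph Q E}
      (ha : a ∈ IsManifold.maximalAtlas 𝓘(ℝ, E) ∞ Q)
      (hb : b ∈ IsManifold.maximalAtlas 𝓘(ℝ, E) ∞ Q), γ t ∈ a.source → γ t ∈ b.source →
      MomentumEquation L a γ (fun s => momentumAt a ha (σ s)) t →
      MomentumEquation L b γ (fun s => momentumAt b hb (σ s)) t := by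
    intro a b ha hb hta htb hm
    refine hm.change_chart hL hb ha hγ htb hta
      ((contDiffAt_momentumAt h hγ hσ ha hta).differentiableAt (by simp)) ?_
    filter_upwards [hσ, hγ.eventually_nhds, hγ.comp_chart ha hta, hγ.comp_chart hb htb]
      with s h3 h4 h5 h6
    have h7 : (σ s).proj.proj = γ s := by rw [h3, HOTangent.proj_lift]
    rw [momentumAt_eq_comp hb ha (h7 ▸ h6.1) (h7 ▸ h5.1), h3, coord_lift_eq_jet h4 hb h6.1]
  exact h1.trans ⟨hswap _ he ht' ht, hswap he _ ht ht'⟩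

end LagrangianInCharts

/-! ### Ostrogradsky momenta -/

section Ostrogradsky

variable {F : Type*} [NormedAddCommGroup F] [NormedSpace ℝ F]

/-- The recursion `r₀ = a₀`, `rᵢ₊₁ = aᵢ₊₁ - rᵢ'` for the Ostrogradsky momenta. -/
def ostrogradsky (a : ℕ → ℝ → F) : ℕ → ℝ → F
  | 0 => a 0
  | i + 1 => fun s => a (i + 1) s - deriv (ostrogradsky a i) s

theorem contDiffAt_ostrogradsky {a : ℕ → ℝ → F} {s : ℝ} (ha : ∀ i, ContDiffAt ℝ ∞ (a i) s)
    (i : ℕ) : ContDiffAt ℝ ∞ (ostrogradsky a i) s := by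
  induction i with
  | zero => exact ha 0
  | succ i ih => exact (ha (i + 1)).sub (contDiffAt_deriv ih)

/-- Induction on `i`: differentiating the sum raises each order by one and the minus sign shifts the
signs, while `a (i + 1)` supplies the term j = 0. The identity gets differentiated, so it is carried
on an open set. -/
theorem ostrogradsky_eq_sum {a : ℕ → ℝ → F} {U : Set ℝ} (hU : IsOpen U)
    (ha : ∀ i, ∀ s ∈ U, ContDiffAt ℝ ∞ (a i) s) (i : ℕ) :
    ∀ s ∈ U, ostrogradsky a i s =
      ∑ j ∈ Finset.range (i + 1), (-1 : ℝ) ^ j • iteratedDeriv j (a (i - j)) s := by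
  induction i with
  | zero => intro s _; simp [ostrogradsky]
  | succ i ih =>
    intro s hs
    have h1 : ostrogradsky a i =ᶠ[𝓝 s] fun s =>
        ∑ j ∈ Finset.range (i + 1), (-1 : ℝ) ^ j • iteratedDeriv j (a (i - j)) s := by
      filter_upwards [hU.mem_nhds hs] with r hr using ih r hr
    have h2 : HasDerivAt (fun s =>
        ∑ j ∈ Finset.range (i + 1), (-1 : ℝ) ^ j • iteratedDeriv j (a (i - j)) s)
        (∑ j ∈ Finset.range (i + 1), (-1 : ℝ) ^ j • iteratedDeriv (j + 1) (a (i - j)) s) s := by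
      refine HasDerivAt.fun_sum fun j _ => HasDerivAt.const_smul _ ?_
      rw [iteratedDeriv_succ]
      exact ((contDiffAt_iteratedDeriv (ha (i - j) s hs) j).differentiableAt
        (by simp)).hasDerivAt
    change a (i + 1) s - deriv (ostrogradsky a i) s = _
    rw [h1.deriv_eq, h2.deriv, Finset.sum_range_succ' _ (i + 1)]
    simp only [pow_succ, mul_neg, mul_one, neg_smul, Finset.sum_neg_distrib,
      Nat.add_sub_add_right, pow_zero, iteratedDeriv_zero, one_smul, Nat.sub_zero]
    abel

variable {E : Type*} [NormedAddCommGroup E] [NormedSpace ℝ E] {m : ℕ}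

/-- The component of a covector at the `i`-th index from the top. -/
def component (ℓ : ℝ → (Fin (m + 2) → E) →L[ℝ] ℝ) (i : ℕ) (s : ℝ) : E →L[ℝ] ℝ :=
  if h : i < m + 2 then
    ℓ s ∘L ContinuousLinearMap.single ℝ (fun _ : Fin (m + 2) => E) (Fin.rev ⟨i, h⟩)
  else 0

theorem component_rev (ℓ : ℝ → (Fin (m + 2) → E) →L[ℝ] ℝ) (j : Fin (m + 2)) (s : ℝ) :
    component ℓ j.rev s = ℓ s ∘L ContinuousLinearMap.single ℝ (fun _ : Fin (m + 2) => E) j := by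
  rw [component, dif_pos j.rev.2, Fin.eta, Fin.rev_rev]

theorem contDiffAt_component {ℓ : ℝ → (Fin (m + 2) → E) →L[ℝ] ℝ} {s : ℝ}
    (h : ContDiffAt ℝ ∞ ℓ s) (i : ℕ) : ContDiffAt ℝ ∞ (component ℓ i) s := by
  unfold component
  split_ifs
  · exact h.clm_comp contDiffAt_const
  · exact contDiffAt_const

/-- The Ostrogradsky momenta of `ℓ = dL`. -/
def ostrogradskyMomentum (ℓ : ℝ → (Fin (m + 2) → E) →L[ℝ] ℝ) (s : ℝ) :
    (Fin (m + 1) → E) →L[ℝ] ℝ :=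
  ∑ j : Fin (m + 1), ostrogradsky (component ℓ) j.rev s ∘L
    ContinuousLinearMap.proj (R := ℝ) (φ := fun _ : Fin (m + 1) => E) j

theorem contDiffAt_ostrogradskyMomentum {ℓ : ℝ → (Fin (m + 2) → E) →L[ℝ] ℝ} {s : ℝ}
    (h : ContDiffAt ℝ ∞ ℓ s) : ContDiffAt ℝ ∞ (ostrogradskyMomentum ℓ) s := by
  unfold ostrogradskyMomentum
  exact ContDiffAt.sum fun j _ =>
    (contDiffAt_ostrogradsky (contDiffAt_component h) _).clm_comp contDiffAt_const

/-- The recursion says that each component of ℓ is r_(i+1) + r_i', except the top one, which is r_0.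
The derivative terms make up P'(head w) and the others P(tail w), up to the leftover r_(m+1), which
vanishes by `h0`. -/
theorem ostrogradskyMomentum_equation {ℓ : ℝ → (Fin (m + 2) → E) →L[ℝ] ℝ} {s : ℝ}
    (h : ContDiffAt ℝ ∞ ℓ s) (h0 : ostrogradsky (component ℓ) (m + 1) s = 0)
    (w : Fin (m + 2) → E) :
    deriv (ostrogradskyMomentum ℓ) s (headL E m w) + ostrogradskyMomentum ℓ s (tailL E m w) =
      ℓ s w := by
  set r := ostrogradsky (component ℓ) with hr
  have hd : HasDerivAt (ostrogradskyMomentum ℓ) (∑ j : Fin (m + 1), deriv (r j.rev) s ∘L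
      ContinuousLinearMap.proj (R := ℝ) (φ := fun _ : Fin (m + 1) => E) j) s := by
    unfold ostrogradskyMomentum
    refine HasDerivAt.fun_sum fun j _ => ?_
    have := (((contDiffAt_ostrogradsky (contDiffAt_component h) j.rev).differentiableAt
      (by simp)).hasDerivAt).clm_comp (hasDerivAt_const s
        (ContinuousLinearMap.proj (R := ℝ) (φ := fun _ : Fin (m + 1) => E) j))
    simpa using this
  have hw : ℓ s w = ∑ j : Fin (m + 2), component ℓ j.rev s (w j) := by
    conv_lhs => rw [← Finset.univ_sum_single w, map_sum]
    refine Finset.sum_congr rfl fun j _ => ?_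
    rw [component_rev]
    rfl
  have h1 : ∀ j : Fin (m + 1), component ℓ j.castSucc.rev s (w j.castSucc) =
      r j.castSucc.rev s (w j.castSucc) + deriv (r j.rev) s (w j.castSucc) := by
    intro j
    rw [Fin.rev_castSucc, Fin.val_succ]
    change _ = (component ℓ (j.rev + 1) s - deriv (r j.rev) s) _ + _
    simp
  -- One sum over m + 2 indices is split at the top, giving the left side, and at the bottom, where
  -- the coefficient r_(m+1) is zero.
  have h2 : ∑ j : Fin (m + 1), r j.castSucc.rev s (w j.castSucc) + r 0 s (w (Fin.last _)) =
      ∑ j : Fin (m + 1), r j.rev s (w j.succ) := by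
    have a1 := Fin.sum_univ_castSucc (fun j : Fin (m + 2) => r j.rev s (w j))
    rw [Fin.sum_univ_succ] at a1
    simp only [Fin.rev_zero, Fin.val_last, h0, zero_apply, zero_add,
      Fin.rev_last, Fin.val_zero, Fin.rev_succ, Fin.val_castSucc] at a1
    exact a1.symm
  have h3 : component ℓ (Fin.last (m + 1)).rev s (w (Fin.last _)) = r 0 s (w (Fin.last _)) := by
    simp [hr, ostrogradsky]
  rw [hd.deriv, hw, Fin.sum_univ_castSucc (fun j : Fin (m + 2) => component ℓ j.rev s (w j)), h3, Finset.sum_congr rfl fun j _ => h1 j,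
    Finset.sum_add_distrib, add_right_comm, h2, add_comm]
  unfold ostrogradskyMomentum
  simp only [sum_apply]
  rfl

theorem headL_single_castSucc (j : Fin (m + 1)) (v : E) :
    headL E m (Pi.single j.castSucc v) = Pi.single j v := by
  funext i
  simp [headL, Pi.single_apply]

theorem headL_single_last (v : E) : headL E m (Pi.single (Fin.last _) v) = 0 := by
  funext i
  simp [headL, (Fin.castSucc_lt_last i).ne]

theorem tailL_single_succ (j : Fin (m + 1)) (v : E) :
    tailL E m (Pi.single j.succ v) = Pi.single j v := by
  funext i
  simp [tailL, Pi.single_apply]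

theorem tailL_single_zero (v : E) : tailL E m (Pi.single 0 v) = 0 := by
  funext i
  simp [tailL]

/-- Converse of `ostrogradskyMomentum_equation`. Basis vectors, taken from the highest coordinate
down, force each component of `P` in turn; the lowest one leaves a compatibility condition, the
Euler-Lagrange equation. -/
theorem eq_ostrogradskyMomentum {ℓ : ℝ → (Fin (m + 2) → E) →L[ℝ] ℝ} {U : Set ℝ} (hU : IsOpen U)
    {P : ℝ → (Fin (m + 1) → E) →L[ℝ] ℝ} (hP : ∀ s ∈ U, DifferentiableAt ℝ P s)
    (h : ∀ s ∈ U, ∀ w, deriv P s (headL E m w) + P s (tailL E m w) = ℓ s w) :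
    ∀ s ∈ U, P s = ostrogradskyMomentum ℓ s ∧ ostrogradsky (component ℓ) (m + 1) s = 0 := by
  set S := fun j : Fin (m + 1) => ContinuousLinearMap.single ℝ (fun _ : Fin (m + 1) => E) j with hS
  have hd : ∀ j, ∀ s ∈ U, deriv (fun s => P s ∘L S j) s = deriv P s ∘L S j := by
    intro j s hs
    have := (hP s hs).hasDerivAt.clm_comp (hasDerivAt_const s (S j))
    rw [this.deriv]
    simp
  have key : ∀ i (hi : i < m + 1), ∀ s ∈ U,
      P s ∘L S (Fin.rev ⟨i, hi⟩) = ostrogradsky (component ℓ) i s := by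
    intro i
    induction i with
    | zero =>
      intro hi s hs
      ext v
      -- The top basis vector has zero head, so no derivative of `P` appears.
      have h1 := h s hs (Pi.single (Fin.last _) v)
      rw [headL_single_last, map_zero, zero_add, ← Fin.succ_last, tailL_single_succ] at h1
      have h2 := component_rev ℓ (Fin.last (m + 1)) s
      rw [Fin.rev_last] at h2
      change P s (Pi.single (Fin.rev (0 : Fin (m + 1))) v) = component ℓ 0 s v
      rw [Fin.rev_zero, h1, Fin.succ_last]
      exact (congrArg (fun f : E →L[ℝ] ℝ => f v) h2).symm
    | succ i ih =>
      intro hi s hs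
      ext v
      set j : Fin (m + 1) := Fin.rev ⟨i, by omega⟩ with hj
      set j' : Fin (m + 1) := Fin.rev ⟨i + 1, hi⟩ with hj'
      have hjj : j'.succ = j.castSucc := by
        ext
        simp [hj, hj', Fin.val_rev]
        omega
      have h1 := h s hs (Pi.single j.castSucc v)
      rw [headL_single_castSucc, ← hjj, tailL_single_succ] at h1
      have h2 := component_rev ℓ j'.succ s
      have h3 : ((Fin.rev j'.succ : Fin (m + 2)) : ℕ) = i + 1 := by
        simp only [hj', Fin.rev_succ, Fin.rev_rev, Fin.val_castSucc]
      rw [h3] at h2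
      -- The inductive identity must hold near `s`, since it is differentiated.
      have h4 : ostrogradsky (component ℓ) i =ᶠ[𝓝 s] fun s => P s ∘L S j := by
        filter_upwards [hU.mem_nhds hs] with r hr using (ih (by omega) r hr).symm
      change P s (Pi.single j' v) =
        (component ℓ (i + 1) s - deriv (ostrogradsky (component ℓ) i) s) v
      rw [h4.deriv_eq, hd j s hs, h2]
      exact eq_sub_of_add_eq' h1
  intro s hs
  constructor
  · ext w
    conv_lhs => rw [← Finset.univ_sum_single w, map_sum]
    unfold ostrogradskyMomentum
    rw [sum_apply]
    refine Finset.sum_congr rfl fun j _ => ?_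
    have h1 := key j.rev j.rev.2 s hs
    rw [Fin.eta, Fin.rev_rev] at h1
    rw [← h1]
    rfl
  · ext v
    -- The bottom basis vector has zero tail: p_0' equals the lowest component of ℓ.
    have h1 := h s hs (Pi.single (Fin.castSucc 0) v)
    rw [headL_single_castSucc, Fin.castSucc_zero, tailL_single_zero, map_zero, add_zero] at h1
    have h2 := component_rev ℓ 0 s
    rw [Fin.rev_zero, Fin.val_last] at h2
    have h4 : ostrogradsky (component ℓ) m =ᶠ[𝓝 s] fun s => P s ∘L S 0 := by
      filter_upwards [hU.mem_nhds hs] with r hr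
      rw [← key m (by omega) r hr]
      congr 2
      ext
      simp [Fin.val_rev]
    change (component ℓ (m + 1) s - deriv (ostrogradsky (component ℓ) m) s) v = 0
    rw [h4.deriv_eq, hd 0 s hs, h2]
    exact sub_eq_zero_of_eq h1.symm

/-- Evaluation at `v` is continuous linear and commutes with iterated derivatives, so the term of
the recursion after the last momentum is the Euler-Lagrange expression. -/
theorem ostrogradsky_apply_eq_sum {ℓ : ℝ → (Fin (m + 2) → E) →L[ℝ] ℝ} {U : Set ℝ} (hU : IsOpen U)
    (h : ∀ s ∈ U, ContDiffAt ℝ ∞ ℓ s) {s : ℝ} (hs : s ∈ U) (v : E) :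
    ostrogradsky (component ℓ) (m + 1) s v = ∑ j : Fin (m + 2), (-1 : ℝ) ^ (j : ℕ) *
      iteratedDeriv j (fun s => ℓ s (Pi.single j v)) s := by
  rw [ostrogradsky_eq_sum hU (fun i s hs => contDiffAt_component (h s hs) i) _ s hs,
    sum_apply, Finset.sum_range]
  refine Finset.sum_congr rfl fun j _ => ?_
  have h1 : m + 1 - (j : ℕ) = j.rev := by simp [Fin.val_rev]
  have h2 : ∀ (i : ℕ) (f : ℝ → E →L[ℝ] ℝ), ContDiffAt ℝ ∞ f s →
      iteratedDeriv i (fun s => f s v) s = iteratedDeriv i f s v := by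
    intro i f hf
    rw [iteratedDeriv_eq_iteratedFDeriv, iteratedDeriv_eq_iteratedFDeriv]
    exact DFunLike.congr_fun ((ContinuousLinearMap.apply ℝ ℝ v).iteratedFDeriv_comp_left hf
      (i := i) (by exact_mod_cast le_top)) _
  rw [h1, smul_apply, smul_eq_mul,
    ← h2 _ _ (contDiffAt_component (h s hs) _)]
  congr 2
  funext s
  rw [component_rev]
  rfl

end Ostrogradsky

/-! ### Solutions of the Lagrangian system -/

section Solutions

variable {E : Type*} [NormedAddCommGroup E] [NormedSpace ℝ E]
  {Q : Type*} [TopologicalSpace Q] [ChartedSpace E Q] [IsManifold 𝓘(ℝ, E) ∞ Q] {k m : ℕ}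

/-- Supplies the arbitrary value of μ outside `J`. -/
theorem lagrangianSubmanifold_nonempty {L : HOTangent E Q (m + 1) → ℝ}
    (hL : ContMDiff (jetModel E (m + 1)) 𝓘(ℝ, ℝ) ∞ L) (x : HOTangent E Q (m + 1)) :
    (lagrangianSubmanifold L).Nonempty := by
  set d : (Fin (m + 2) → E) →L[ℝ] ℝ := fderiv ℝ (localLagrangian L (chartAt E x.proj))
    (HOTangent.coord (chartAt E x.proj) (chart_mem E _) x) with hd
  set S := fun j : Fin (m + 2) => d ∘L ContinuousLinearMap.single ℝ (fun _ : Fin (m + 2) => E) j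
  set pr := fun j : Fin (m + 1) =>
    ContinuousLinearMap.proj (R := ℝ) (φ := fun _ : Fin (m + 1) => E) j
  -- One convenient extension of dL: the derivatives in q_(0), …, q_(m) act on the head, and only
  -- the top one acts on the tail.
  set f : (Fin (m + 1) → E) × (Fin (m + 1) → E) →L[ℝ] ℝ :=
    (∑ j : Fin (m + 1), S j.castSucc ∘L pr j).coprod (S (Fin.last _) ∘L pr (Fin.last _)) with hf
  refine ⟨(⟨HOTangent.canonicalImmersion E Q m x, f⟩ : CotangentTangent E Q m),
    (mem_lagrangianSubmanifold_iff hL rfl).2 fun w => ?_⟩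
  change f (headL E m w, tailL E m w) = d w
  conv_rhs => rw [← Finset.univ_sum_single w, map_sum, Fin.sum_univ_castSucc]
  rw [hf, ContinuousLinearMap.coprod_apply, sum_apply]
  rfl

theorem velocity_congr {σ σ' : ℝ → MomentumSpace E Q m} {t : ℝ} (h : σ =ᶠ[𝓝 t] σ') :
    velocity σ t = velocity σ' t :=
  Bundle.TotalSpace.ext h.self_of_nhds (heq_of_eq
    (congrArg (fun f : ℝ →L[ℝ] (Fin (m + 1) → E) × ((Fin (m + 1) → E) →L[ℝ] ℝ) => f 1)
      h.mfderiv_eq))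

omit [IsManifold 𝓘(ℝ, E) ∞ Q] in
theorem smoothNear_of_contMDiffOn {γ : ℝ → Q} {J : Set ℝ} (hJ : IsOpen J)
    (hγ : ContMDiffOn 𝓘(ℝ, ℝ) 𝓘(ℝ, E) ∞ γ J) {t : ℝ} (ht : t ∈ J) : SmoothNear E γ t := by
  filter_upwards [hJ.mem_nhds ht] with s hs using hγ.contMDiffAt (hJ.mem_nhds hs)

theorem contMDiffAt_lift {γ : ℝ → Q} {t : ℝ} (h : SmoothNear E γ t) :
    ContMDiffAt 𝓘(ℝ, ℝ) (jetModel E k) ∞ (HOTangent.lift E k γ) t := by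
  have hs := mem_chart_source E (γ t)
  have h1 := contMDiffAt_ofCoord (chart_mem E (γ t)) (q := jet k (chartAt E (γ t) ∘ γ) t)
    (by rw [jet_zero]; exact (chartAt E (γ t)).map_source hs)
  refine (h1.comp t (contDiffAt_jet (h.contDiffAt_chart (chart_mem E _) hs)).contMDiffAt
    ).congr_of_eventuallyEq ?_
  filter_upwards [h.eventually_nhds, h.comp_chart (chart_mem E _) hs] with s h2 h3
  exact (ofCoord_jet h2 (chart_mem E _) h3.1).symm

theorem contMDiff_hotangent_proj :
    ContMDiff (jetModel E k) 𝓘(ℝ, E) ∞ (HOTangent.proj : HOTangent E Q k → Q) := by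
  intro x
  have hs := mem_chart_source E x.proj
  have h1 := contMDiffAt_symm_of_mem_maximalAtlas (chart_mem E x.proj)
    (coord_zero_mem (chart_mem E _) hs hs).1
  have h2 : ContMDiffAt 𝓘(ℝ, Fin (k + 1) → E) 𝓘(ℝ, E) ∞ (fun q : Fin (k + 1) → E => q 0)
      (HOTangent.coord (chartAt E x.proj) (chart_mem E _) x) :=
    (contDiff_apply ℝ E (0 : Fin (k + 1))).contMDiff.contMDiffAt
  refine ((ContMDiffAt.comp (g := (chartAt E x.proj).symm)
    (HOTangent.coord (chartAt E x.proj) (chart_mem E _) x) h1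
    (f := fun q : Fin (k + 1) → E => q 0) h2).comp x
      (contMDiffAt_coord (chart_mem E x.proj) hs)).congr_of_eventuallyEq ?_
  filter_upwards [chart_source_mem_nhds (Fin (k + 1) → E) x] with z hz
  exact ((congrArg _ (coord_zero (chart_mem E _) hz)).trans ((chartAt E x.proj).left_inv hz)).symm

/-- The differential of `L` along the lift of `γ`, in natural coordinates. -/
def differentialAlong (L : HOTangent E Q (m + 1) → ℝ) (e : OpenPartialHomeomorph Q E) (γ : ℝ → Q)
    (s : ℝ) : (Fin (m + 2) → E) →L[ℝ] ℝ :=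
  fderiv ℝ (localLagrangian L e) (jet (m + 1) (e ∘ γ) s)

section

variable {L : HOTangent E Q (m + 1) → ℝ} {J : Set ℝ} {γ : ℝ → Q}

theorem contDiffAt_differentialAlong (hL : ContMDiff (jetModel E (m + 1)) 𝓘(ℝ, ℝ) ∞ L)
    {e : OpenPartialHomeomorph Q E} (he : e ∈ IsManifold.maximalAtlas 𝓘(ℝ, E) ∞ Q) {t : ℝ}
    (hγ : SmoothNear E γ t) (ht : γ t ∈ e.source) :
    ContDiffAt ℝ ∞ (differentialAlong L e γ) t :=
  ((contDiffAt_localLagrangian hL he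
    (by rw [jet_zero]; exact e.map_source ht)).fderiv_right (m := ∞) (by simp)).comp t
      (contDiffAt_jet (hγ.contDiffAt_chart he ht))

omit [IsManifold 𝓘(ℝ, E) ∞ Q] in
theorem isOpen_inter_chart (hJ : IsOpen J) (hγ : ContMDiffOn 𝓘(ℝ, ℝ) 𝓘(ℝ, E) ∞ γ J)
    (e : OpenPartialHomeomorph Q E) : IsOpen (J ∩ γ ⁻¹' e.source) :=
  hγ.continuousOn.isOpen_inter_preimage hJ e.open_source

theorem isEulerLagrangeSolution_iff (hL : ContMDiff (jetModel E (m + 1)) 𝓘(ℝ, ℝ) ∞ L)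
    (hJ : IsOpen J) (hγ : ContMDiffOn 𝓘(ℝ, ℝ) 𝓘(ℝ, E) ∞ γ J) :
    IsEulerLagrangeSolution L J γ ↔ ∀ e ∈ IsManifold.maximalAtlas 𝓘(ℝ, E) ∞ Q,
      ∀ t ∈ J ∩ γ ⁻¹' e.source,
        ostrogradsky (component (differentialAlong L e γ)) (m + 1) t = 0 := by
  have key : ∀ e ∈ IsManifold.maximalAtlas 𝓘(ℝ, E) ∞ Q, ∀ t ∈ J ∩ γ ⁻¹' e.source, ∀ v : E,
      ostrogradsky (component (differentialAlong L e γ)) (m + 1) t v = _ := fun e he t ht v =>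
    ostrogradsky_apply_eq_sum (isOpen_inter_chart hJ hγ e) (fun s hs =>
      contDiffAt_differentialAlong hL he (smoothNear_of_contMDiffOn hJ hγ hs.1) hs.2) ht v
  constructor
  · intro h e he t ht
    ext v
    rw [key e he t ht v]
    exact h e he t ht.1 ht.2 v
  · intro h e he t ht hs v
    refine (key e he t ⟨ht, hs⟩ v).symm.trans ?_
    rw [h e he t ⟨ht, hs⟩]
    rfl

/-- Momenta over the lift of a curve are determined by the generalized momentum equations. -/
theorem momentumAt_eq_ostrogradskyMomentum (hL : ContMDiff (jetModel E (m + 1)) 𝓘(ℝ, ℝ) ∞ L)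
    (hJ : IsOpen J) (hγ : ContMDiffOn 𝓘(ℝ, ℝ) 𝓘(ℝ, E) ∞ γ J) {σ : ℝ → MomentumSpace E Q m}
    (hσ : ∀ t ∈ J, ContMDiffAt 𝓘(ℝ, ℝ) (cotangentModel (jetModel E m)) ∞ σ t)
    (hp : ∀ t ∈ J, (σ t).proj = HOTangent.lift E m γ t)
    (hv : ∀ t ∈ J, velocity σ t ∈ dynamicsSubmanifold L)
    {e : OpenPartialHomeomorph Q E} (he : e ∈ IsManifold.maximalAtlas 𝓘(ℝ, E) ∞ Q) :
    ∀ t ∈ J ∩ γ ⁻¹' e.source,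
      momentumAt e he (σ t) = ostrogradskyMomentum (differentialAlong L e γ) t ∧
        ostrogradsky (component (differentialAlong L e γ)) (m + 1) t = 0 := by
  have hp' : ∀ t ∈ J, ∀ᶠ s in 𝓝 t, (σ s).proj = HOTangent.lift E m γ s := fun t ht => by
    filter_upwards [hJ.mem_nhds ht] with s hs using hp s hs
  refine eq_ostrogradskyMomentum (P := fun s => momentumAt e he (σ s))
    (isOpen_inter_chart hJ hγ e) (fun s hs => ?_) (fun s hs => ?_)
  · exact (contDiffAt_momentumAt (hσ s hs.1) (smoothNear_of_contMDiffOn hJ hγ hs.1)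
      (hp' s hs.1) he hs.2).differentiableAt (by simp)
  · exact (velocity_mem_dynamicsSubmanifold_iff hL (hσ s hs.1)
      (smoothNear_of_contMDiffOn hJ hγ hs.1) (hp' s hs.1) he hs.2).1 (hv s hs.1)

theorem momentumSpace_ext {p p' : MomentumSpace E Q m} (h : p.proj = p'.proj)
    (h' : momentumAt (chartAt E p.proj.proj) (chart_mem E _) p =
      momentumAt (chartAt E p.proj.proj) (chart_mem E _) p') : p = p' := by
  rw [← momentumIn_eq_momentumAt, ← momentumIn_eq_momentumAt, momentumIn_self, h,
    momentumIn_self] at h'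
  exact Bundle.TotalSpace.ext h (heq_of_eq h')

/-- Take μ = α(dσ/dt), which lies in Σ_L by `hv`. Then 𝔽L(μ) is the base point of the velocity,
namely σ, and (∗) becomes a tautology on the open set `J`. -/
theorem exists_isLegendreSolution (hL : ContMDiff (jetModel E (m + 1)) 𝓘(ℝ, ℝ) ∞ L)
    (hJ : IsOpen J) (hγ : ContMDiffOn 𝓘(ℝ, ℝ) 𝓘(ℝ, E) ∞ γ J) {σ : ℝ → MomentumSpace E Q m}
    (hσ : ∀ t ∈ J, ContMDiffAt 𝓘(ℝ, ℝ) (cotangentModel (jetModel E m)) ∞ σ t)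
    (hp : ∀ t ∈ J, (σ t).proj = HOTangent.lift E m γ t)
    (hv : ∀ t ∈ J, velocity σ t ∈ dynamicsSubmanifold L) :
    ∃ μ, IsLegendreSolution L J γ μ ∧ ∀ t ∈ J, higherLegendre L (μ t) = σ t := by
  classical
  obtain ⟨μ₀, hμ₀⟩ := lagrangianSubmanifold_nonempty hL (HOTangent.lift E (m + 1) γ 0)
  set μ : ℝ → lagrangianSubmanifold L := fun t =>
    if h : t ∈ J then ⟨_, hv t h⟩ else ⟨μ₀, hμ₀⟩ with hμ
  have hμt : ∀ t ∈ J, (μ t : CotangentTangent E Q m) =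
      tulczyjewAlpha (jetModel E m) (HOTangent E Q m) (velocity σ t) := by
    intro t ht
    simp only [hμ, dif_pos ht]
  have hleg : ∀ t ∈ J, higherLegendre L (μ t) = σ t := by
    intro t ht
    unfold higherLegendre
    rw [hμt t ht, Equiv.symm_apply_apply]
    rfl
  refine ⟨μ, ⟨fun t ht => ?_, fun t ht => ?_, fun t ht => ?_⟩, hleg⟩
  · refine ContMDiffAt.contMDiffWithinAt ?_
    have h1 := contMDiffAt_tulczyjewAlpha_velocity (σ := σ) (t := t) (by
      filter_upwards [hJ.mem_nhds ht] with s hs using hσ s hs)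
    refine h1.congr_of_eventuallyEq ?_
    filter_upwards [hJ.mem_nhds ht] with s hs using hμt s hs
  · rw [hμt t ht]
    refine tulczyjewAlpha_velocity_proj (hσ t ht) (smoothNear_of_contMDiffOn hJ hγ ht) ?_
    filter_upwards [hJ.mem_nhds ht] with s hs using hp s hs
  · rw [hμt t ht, Equiv.symm_apply_apply]
    refine (velocity_congr ?_).symm
    filter_upwards [hJ.mem_nhds ht] with s hs using hleg s hs

theorem IsLegendreSolution.contMDiffAt_higherLegendre {μ : ℝ → lagrangianSubmanifold L}
    (h : IsLegendreSolution L J γ μ) (hJ : IsOpen J) {t : ℝ} (ht : t ∈ J) :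
    ContMDiffAt 𝓘(ℝ, ℝ) (cotangentModel (jetModel E m)) ∞ (fun s => higherLegendre L (μ s)) t :=
  contMDiffAt_tulczyjewAlpha_symm_proj (h.smooth.contMDiffAt (hJ.mem_nhds ht))

theorem IsLegendreSolution.higherLegendre_proj {μ : ℝ → lagrangianSubmanifold L}
    (h : IsLegendreSolution L J γ μ) {t : ℝ} (hγ : SmoothNear E γ t) (ht : t ∈ J) :
    (higherLegendre L (μ t)).proj = HOTangent.lift E m γ t := by
  change (μ t : CotangentTangent E Q m).proj.proj = _
  rw [h.proj_eq t ht, canonicalImmersion_lift hγ]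

theorem IsLegendreSolution.alpha_velocity {μ : ℝ → lagrangianSubmanifold L}
    (h : IsLegendreSolution L J γ μ) {t : ℝ} (ht : t ∈ J) :
    tulczyjewAlpha (jetModel E m) (HOTangent E Q m)
      (velocity (fun s => higherLegendre L (μ s)) t) = μ t := by
  rw [← h.alpha_symm_eq t ht, Equiv.apply_symm_apply]

theorem IsLegendreSolution.velocity_mem {μ : ℝ → lagrangianSubmanifold L}
    (h : IsLegendreSolution L J γ μ) {t : ℝ} (ht : t ∈ J) :
    velocity (fun s => higherLegendre L (μ s)) t ∈ dynamicsSubmanifold L := by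
  change tulczyjewAlpha (jetModel E m) (HOTangent E Q m) _ ∈ lagrangianSubmanifold L
  rw [h.alpha_velocity ht]
  exact (μ t).2

theorem IsLegendreSolution.isEulerLagrangeSolution
    (hL : ContMDiff (jetModel E (m + 1)) 𝓘(ℝ, ℝ) ∞ L)
    (hJ : IsOpen J) (hγ : ContMDiffOn 𝓘(ℝ, ℝ) 𝓘(ℝ, E) ∞ γ J) {μ : ℝ → lagrangianSubmanifold L}
    (h : IsLegendreSolution L J γ μ) : IsEulerLagrangeSolution L J γ :=
  (isEulerLagrangeSolution_iff hL hJ hγ).2 fun _ he t ht =>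
    (momentumAt_eq_ostrogradskyMomentum hL hJ hγ (fun _ => h.contMDiffAt_higherLegendre hJ)
      (fun _ hs => h.higherLegendre_proj (smoothNear_of_contMDiffOn hJ hγ hs) hs)
      (fun _ => h.velocity_mem) he t ht).2

/-- The curve 𝔽L ∘ μ lies over the lift of γ and its momenta are the Ostrogradsky momenta, so it
depends on γ alone. Then μ = α(d/dt 𝔽L(μ)) does too. -/
theorem IsLegendreSolution.eqOn (hL : ContMDiff (jetModel E (m + 1)) 𝓘(ℝ, ℝ) ∞ L)
    (hJ : IsOpen J) (hγ : ContMDiffOn 𝓘(ℝ, ℝ) 𝓘(ℝ, E) ∞ γ J) {μ ν : ℝ → lagrangianSubmanifold L}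
    (hμ : IsLegendreSolution L J γ μ) (hν : IsLegendreSolution L J γ ν) : EqOn μ ν J := by
  have h1 : ∀ t ∈ J, higherLegendre L (μ t) = higherLegendre L (ν t) := by
    intro t ht
    have hn := smoothNear_of_contMDiffOn hJ hγ ht
    have hp := hμ.higherLegendre_proj hn ht
    refine momentumSpace_ext (hp.trans (hν.higherLegendre_proj hn ht).symm) ?_
    have hm : t ∈ J ∩ γ ⁻¹' (chartAt E (higherLegendre L (μ t)).proj.proj).source := by
      refine ⟨ht, ?_⟩
      rw [hp, HOTangent.proj_lift]
      exact mem_chart_source E (γ t)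
    rw [(momentumAt_eq_ostrogradskyMomentum hL hJ hγ (fun _ => hμ.contMDiffAt_higherLegendre hJ)
      (fun _ hs => hμ.higherLegendre_proj (smoothNear_of_contMDiffOn hJ hγ hs) hs)
      (fun _ => hμ.velocity_mem) _ t hm).1,
      (momentumAt_eq_ostrogradskyMomentum hL hJ hγ (fun _ => hν.contMDiffAt_higherLegendre hJ)
      (fun _ hs => hν.higherLegendre_proj (smoothNear_of_contMDiffOn hJ hγ hs) hs)
      (fun _ => hν.velocity_mem) _ t hm).1]
  intro t ht
  refine Subtype.ext ?_
  rw [← hμ.alpha_velocity ht, ← hν.alpha_velocity ht]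
  refine congrArg _ (velocity_congr ?_)
  filter_upwards [hJ.mem_nhds ht] with s hs using h1 s hs

/-- The curve in `T^* T^(m) Q` over the lift of `γ` given by the Ostrogradsky momenta. -/
def ostrogradskyCurve (L : HOTangent E Q (m + 1) → ℝ) (γ : ℝ → Q) (t : ℝ) : MomentumSpace E Q m :=
  ⟨HOTangent.lift E m γ t,
    ostrogradskyMomentum (differentialAlong L (chartAt E (γ t)) γ) t⟩

theorem momentumEquation_ostrogradskyMomentum
    (hL : ContMDiff (jetModel E (m + 1)) 𝓘(ℝ, ℝ) ∞ L)
    (hJ : IsOpen J) (hγ : ContMDiffOn 𝓘(ℝ, ℝ) 𝓘(ℝ, E) ∞ γ J) (h : IsEulerLagrangeSolution L J γ)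
    {e : OpenPartialHomeomorph Q E} (he : e ∈ IsManifold.maximalAtlas 𝓘(ℝ, E) ∞ Q) {t : ℝ}
    (ht : t ∈ J ∩ γ ⁻¹' e.source) :
    MomentumEquation L e γ (ostrogradskyMomentum (differentialAlong L e γ)) t :=
  ostrogradskyMomentum_equation
    (contDiffAt_differentialAlong hL he (smoothNear_of_contMDiffOn hJ hγ ht.1) ht.2)
    ((isEulerLagrangeSolution_iff hL hJ hγ).1 h e he t ht)

/-- The gluing step. The momenta of the chart at `γ t`, pulled back to `e`, still solve the momentum
equation by `MomentumEquation.change_chart`, and solutions in `e` are unique. No transformation law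
for Ostrogradsky momenta has to be computed. -/
theorem momentumAt_ostrogradskyCurve (hL : ContMDiff (jetModel E (m + 1)) 𝓘(ℝ, ℝ) ∞ L)
    (hJ : IsOpen J) (hγ : ContMDiffOn 𝓘(ℝ, ℝ) 𝓘(ℝ, E) ∞ γ J) (h : IsEulerLagrangeSolution L J γ)
    {e : OpenPartialHomeomorph Q E} (he : e ∈ IsManifold.maximalAtlas 𝓘(ℝ, E) ∞ Q) {t : ℝ}
    (ht : t ∈ J ∩ γ ⁻¹' e.source) :
    momentumAt e he (ostrogradskyCurve L γ t) =
      ostrogradskyMomentum (differentialAlong L e γ) t := by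
  set e' := chartAt E (γ t) with he'
  have he'm : e' ∈ IsManifold.maximalAtlas 𝓘(ℝ, E) ∞ Q := chart_mem E _
  set P' := ostrogradskyMomentum (differentialAlong L e' γ) with hP'
  set P : ℝ → (Fin (m + 1) → E) →L[ℝ] ℝ := fun s =>
    P' s ∘L fderiv ℝ (jetTransition m e e' he'm) (jet m (e ∘ γ) s) with hP
  have hU := (isOpen_inter_chart hJ hγ e).inter (isOpen_inter_chart hJ hγ e')
  have hmem : t ∈ (J ∩ γ ⁻¹' e.source) ∩ (J ∩ γ ⁻¹' e'.source) :=
    ⟨ht, ht.1, mem_chart_source E (γ t)⟩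
  have hsm' : ∀ s ∈ (J ∩ γ ⁻¹' e.source) ∩ (J ∩ γ ⁻¹' e'.source), DifferentiableAt ℝ P' s :=
    fun s hs => (contDiffAt_ostrogradskyMomentum (contDiffAt_differentialAlong hL he'm
      (smoothNear_of_contMDiffOn hJ hγ hs.2.1) hs.2.2)).differentiableAt (by simp)
  -- Uniqueness is applied on the times at which γ lies in both charts.
  have h1 := (eq_ostrogradskyMomentum (ℓ := differentialAlong L e γ) (P := P) hU
    (fun s hs => ?_) (fun s hs => ?_) t hmem).1
  · rw [← h1]
    have key : ∀ y (hy : y = γ t), (P' t ∘L fderiv ℝ (jetTransition m e (chartAt E y) (chart_mem E _))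
        (HOTangent.coord e he (HOTangent.lift E m γ t))) = P t := by
      rintro _ rfl
      rw [coord_lift_eq_jet (smoothNear_of_contMDiffOn hJ hγ ht.1) he ht.2]
    exact key _ (HOTangent.proj_lift γ t)
  · have hn := smoothNear_of_contMDiffOn hJ hγ hs.1.1
    have h2 := (contDiffAt_jetTransition he he'm (q := jet m (e ∘ γ) s)
      (by rw [jet_zero]; exact e.map_source hs.1.2)
      (by rw [jet_zero, Function.comp_apply, e.left_inv hs.1.2]; exact hs.2.2)).fderiv_right
        (m := ∞) (by simp)
    exact (hsm' s hs).clm_comp ((h2.comp s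
      (contDiffAt_jet (hn.contDiffAt_chart he hs.1.2))).differentiableAt (by simp))
  · exact MomentumEquation.change_chart hL he he'm (smoothNear_of_contMDiffOn hJ hγ hs.1.1)
      hs.1.2 hs.2.2 (hsm' s hs) (EventuallyEq.refl _ _)
      (momentumEquation_ostrogradskyMomentum hL hJ hγ h he'm hs.2)

/-- The defining chart of `ostrogradskyCurve` jumps with time, so smoothness is read off in one
fixed chart, where the momenta are given by a single smooth formula. -/
theorem contMDiffAt_ostrogradskyCurve (hL : ContMDiff (jetModel E (m + 1)) 𝓘(ℝ, ℝ) ∞ L)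
    (hJ : IsOpen J) (hγ : ContMDiffOn 𝓘(ℝ, ℝ) 𝓘(ℝ, E) ∞ γ J) (h : IsEulerLagrangeSolution L J γ)
    {t : ℝ} (ht : t ∈ J) :
    ContMDiffAt 𝓘(ℝ, ℝ) (cotangentModel (jetModel E m)) ∞ (ostrogradskyCurve L γ) t := by
  have hn := smoothNear_of_contMDiffOn hJ hγ ht
  refine contMDiffAt_cotangent_iff.2 ⟨contMDiffAt_lift hn, ?_⟩
  set e := chartAt E (ostrogradskyCurve L γ t).proj.proj with he
  have hem : e ∈ IsManifold.maximalAtlas 𝓘(ℝ, E) ∞ Q := chart_mem E _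
  have hs : t ∈ J ∩ γ ⁻¹' e.source := by
    refine ⟨ht, ?_⟩
    have : (ostrogradskyCurve L γ t).proj.proj = γ t := HOTangent.proj_lift γ t
    rw [he, this]
    exact mem_chart_source E (γ t)
  refine (contDiffAt_ostrogradskyMomentum
    (contDiffAt_differentialAlong hL hem hn hs.2)).congr_of_eventuallyEq ?_
  filter_upwards [(isOpen_inter_chart hJ hγ e).mem_nhds hs] with s hs
  rw [momentumIn_eq_momentumAt]
  exact momentumAt_ostrogradskyCurve hL hJ hγ h hem hs

theorem IsEulerLagrangeSolution.exists_isLegendreSolution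
    (hL : ContMDiff (jetModel E (m + 1)) 𝓘(ℝ, ℝ) ∞ L)
    (hJ : IsOpen J) (hγ : ContMDiffOn 𝓘(ℝ, ℝ) 𝓘(ℝ, E) ∞ γ J)
    (h : IsEulerLagrangeSolution L J γ) : ∃ μ, IsLegendreSolution L J γ μ := by
  have hsm := fun t (ht : t ∈ J) => contMDiffAt_ostrogradskyCurve hL hJ hγ h ht
  obtain ⟨μ, hμ, -⟩ := HigherOrderTangent.exists_isLegendreSolution hL hJ hγ
    (σ := ostrogradskyCurve L γ) hsm (fun _ _ => rfl) fun t ht => by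
      have hs := mem_chart_source E (γ t)
      refine (velocity_mem_dynamicsSubmanifold_iff hL (hsm t ht)
        (smoothNear_of_contMDiffOn hJ hγ ht) (Eventually.of_forall fun _ => rfl)
        (chart_mem E (γ t)) hs).2 ?_
      have hev : (fun s => momentumAt (chartAt E (γ t)) (chart_mem E _)
          (ostrogradskyCurve L γ s)) =ᶠ[𝓝 t]
          ostrogradskyMomentum (differentialAlong L (chartAt E (γ t)) γ) := by
        filter_upwards [(isOpen_inter_chart hJ hγ (chartAt E (γ t))).mem_nhds ⟨ht, hs⟩] with s hs
        exact momentumAt_ostrogradskyCurve hL hJ hγ h (chart_mem E _) hs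
      intro w
      rw [hev.deriv_eq, hev.self_of_nhds]
      exact momentumEquation_ostrogradskyMomentum hL hJ hγ h (chart_mem E _) ⟨ht, hs⟩ w
  exact ⟨μ, hμ⟩

/-- The base curve of a solution of the implicit dynamics `N_L` is holonomic. -/
theorem proj_eq_lift_of_velocity_mem (hJ : IsOpen J) {σ : ℝ → MomentumSpace E Q m}
    (hσ : ∀ t ∈ J, ContMDiffAt 𝓘(ℝ, ℝ) (cotangentModel (jetModel E m)) ∞ σ t)
    (hv : ∀ t ∈ J, velocity σ t ∈ dynamicsSubmanifold L)
    (hγ : ContMDiffOn 𝓘(ℝ, ℝ) 𝓘(ℝ, E) ∞ (fun s => (σ s).proj.proj) J) :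
    ∀ t ∈ J, (σ t).proj = HOTangent.lift E m (fun s => (σ s).proj.proj) t := by
  intro t ht
  set γ : ℝ → Q := fun s => (σ s).proj.proj with hγd
  set e := chartAt E (γ t) with he
  have hem : e ∈ IsManifold.maximalAtlas 𝓘(ℝ, E) ∞ Q := chart_mem E _
  set q : ℝ → Fin (m + 1) → E := fun s => HOTangent.coord e hem (σ s).proj with hq
  have hU := isOpen_inter_chart hJ hγ e
  -- Only the base point j(x) of α(dσ/dt) matters here: with r the coordinates of x, the position is
  -- the head of r and the velocity is its tail.
  have hd : ∀ s ∈ J ∩ γ ⁻¹' e.source, ∃ r : Fin (m + 2) → E,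
      headL E m r = q s ∧ HasDerivAt q (tailL E m r) s := by
    intro s hs
    obtain ⟨x, ν, hx, -⟩ := hv s hs.1
    have h1 := (hasDerivAt_cotangent ((hσ s hs.1).mdifferentiableAt (by simp))).1
    have hc := (contMDiffAt_cotangent_iff.1 (hσ s hs.1)).1.continuousAt
    have h2 := hasDerivAt_chartAt_comp (x₀ := (σ t).proj) (c := fun s => (σ s).proj) h1 hc hs.2
    have hb : (⟨(σ s).proj, _⟩ : TangentBundle (jetModel E m) (HOTangent E Q m)) =
      HOTangent.canonicalImmersion E Q m x := congrArg Bundle.TotalSpace.proj hx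
    have hxs : x.proj ∈ e.source := by
      rw [← proj_canonicalImmersion_proj, ← hb]
      exact hs.2
    have h3 := tangentCoordChange_canonicalImmersion_snd (y := (σ t).proj) hxs
    rw [← hb] at h3
    refine ⟨HOTangent.coord e hem x, ?_, ?_⟩
    · rw [← coord_canonicalImmersion_proj hem hxs, ← hb]
    · rw [← h3]
      exact h2
  -- Since q_(j)' = q_(j+1), induction makes q_(j) the j-th derivative of q_(0) = e ∘ γ.
  have hj : ∀ j (hj : j < m + 1), ∀ s ∈ J ∩ γ ⁻¹' e.source,
      iteratedDeriv j (e ∘ γ) s = q s ⟨j, hj⟩ := by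
    intro j
    induction j with
    | zero =>
      intro hj s hs
      rw [iteratedDeriv_zero]
      exact (coord_zero hem hs.2).symm
    | succ j ih =>
      intro hj s hs
      obtain ⟨r, hr, hr'⟩ := hd s hs
      have h1 : iteratedDeriv j (e ∘ γ) =ᶠ[𝓝 s] fun s => q s ⟨j, by omega⟩ := by
        filter_upwards [hU.mem_nhds hs] with u hu using ih (by omega) u hu
      rw [iteratedDeriv_succ, h1.deriv_eq, (hasDerivAt_pi.1 hr' ⟨j, by omega⟩).deriv, ← hr]
      rfl
  have hs := mem_chart_source E (γ t)
  rw [← HOTangent.ofCoord_coord hem (x := (σ t).proj) hs,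
    ← ofCoord_jet (smoothNear_of_contMDiffOn hJ hγ ht) hem hs]
  congr 1
  funext j
  exact (hj j j.2 t ⟨ht, hs⟩).symm

end

end Solutions

end HigherOrderTangent

end

/-! ### The main theorem -/

theorem mainTheorem5 {E : Type*} [NormedAddCommGroup E] [NormedSpace ℝ E] [FiniteDimensional ℝ E]
    {Q : Type*} [TopologicalSpace Q] [T2Space Q] [SecondCountableTopology Q] [ChartedSpace E Q]
    [IsManifold 𝓘(ℝ, E) ∞ Q] (m : ℕ) (L : HOTangent E Q (m + 1) → ℝ)
    (hL : ContMDiff (jetModel E (m + 1)) 𝓘(ℝ, ℝ) ∞ L) (J : Set ℝ) (hJ : IsOpen J) :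
    (∀ γ : ℝ → Q, ContMDiffOn 𝓘(ℝ, ℝ) 𝓘(ℝ, E) ∞ γ J →
      (IsEulerLagrangeSolution L J γ ↔ ∃ μ, IsLegendreSolution L J γ μ) ∧
      ∀ μ ν, IsLegendreSolution L J γ μ → IsLegendreSolution L J γ ν → EqOn μ ν J) ∧
    (∀ σ : ℝ → MomentumSpace E Q m,
      ContMDiffOn 𝓘(ℝ, ℝ) (cotangentModel (jetModel E m)) ∞ σ J →
      ((∀ t ∈ J, velocity σ t ∈ dynamicsSubmanifold L) ↔
        ∃ γ μ, ContMDiffOn 𝓘(ℝ, ℝ) 𝓘(ℝ, E) ∞ γ J ∧ IsLegendreSolution L J γ μ ∧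
          ∀ t ∈ J, higherLegendre L (μ t) = σ t)) := by
  refine ⟨fun γ hγ => ⟨⟨fun h => h.exists_isLegendreSolution hL hJ hγ,
    fun ⟨μ, h⟩ => h.isEulerLagrangeSolution hL hJ hγ⟩, fun μ ν hμ hν => hμ.eqOn hL hJ hγ hν⟩,
    fun σ hσ => ⟨fun hv => ?_, ?_⟩⟩
  · have hσ' := fun t (ht : t ∈ J) => hσ.contMDiffAt (hJ.mem_nhds ht)
    -- The only candidate for γ is the projection of σ to `Q`; that σ lies over its lift is part of
    -- the dynamics.
    have hγ : ContMDiffOn 𝓘(ℝ, ℝ) 𝓘(ℝ, E) ∞ (fun s => (σ s).proj.proj) J := fun t ht =>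
      ((contMDiff_hotangent_proj.contMDiffAt (x := (σ t).proj)).comp t
        (contMDiffAt_cotangent_iff.1 (hσ' t ht)).1).contMDiffWithinAt
    obtain ⟨μ, hμ, h⟩ := exists_isLegendreSolution hL hJ hγ hσ'
      (proj_eq_lift_of_velocity_mem hJ hσ' hv hγ) hv
    exact ⟨_, μ, hγ, hμ, h⟩
  · rintro ⟨γ, μ, -, hμ, h⟩ t ht
    -- Agreement on the open set `J` gives equal velocities, and a Legendre solution has its
    -- velocity in N_L.
    have hev : (fun s => higherLegendre L (μ s)) =ᶠ[𝓝 t] σ := by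
      filter_upwards [hJ.mem_nhds ht] with s hs using h s hs
    rw [← velocity_congr hev]
    exact hμ.velocity_mem ht
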